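/- **Lemma.** There is a universal constant $C>0$ such that the following holds. Let $n,m\ge 2$ and $M\ge 0$ be integers, let $A:\mathbb R^n\to\mathbb R^m$ be a linear map, and put $\|A\|_{2\to\infty}=\max_{\|x\|_2\le 1}\|Ax\|_\infty$. Let $f_1,\dots,f_M:\mathbb R^m\to\mathbb R$ be functions that are Lipschitz with respect to $\|\cdot\|_\infty$, and let $$\alpha=\max_{1\le j\le M}\ \sup_{z\ne z'}\frac{|f_j(z)-f_j(z')|}{\|z-z'\|_\infty}$$ be the largest of their Lipschitz constants. Let $T\subseteq B_2^n=\{x\in\mathbb R^n:\|x\|_2\le 1\}$, and let $\varepsilon_1,\dots,\varepsilon_M$ be i.i.d. uniformly random signs $\pm1$. Then $\sup_{x\in T}\sum_{j} f_j(Ax)^2$ is finite, $\sup_{x\in T}\sum_j\varepsilon_j f_j(Ax)^2$ is integrable, and $$\mathbb E\,\sup_{x\in T}\sum_{j=1}^M \varepsilon_j f_j(Ax)^2\ \le\ C\sqrt{\log m\,\log n}\;\|A\|_{2\to\infty}\;\alpha\;\sup_{x\in T}\Big(\sum_{j=1}^M f_j(Ax)^2\Big)^{1/2}.$$ (If $T=\emptyset$,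 the suprema over $T$ are read as $0$; if $M=0$, then $\alpha=0$.) **Sparsification bound.** For a weighted hypergraph $H=(V,E,w)$ (with $V$ finite, $E$ a set of subsets of $V$, and $w_e\ge 0$ for $e\in E$), let $$Q_H(x)=\sum_{e\in E}w_e\max_{\{u,v\}\subseteq e,\ u\neq v}(x_u-x_v)^2,\qquad x\in\mathbb R^V,$$ where the maximum is $0$ if $|e|<2$. There is a universal constant $C'>0$ such that for every weighted hypergraph $H=(V,E,w)$ with $n=|V|$ vertices and every $\varepsilon>0$ there is a spectral $\varepsilon$-sparsifier for $H$ with at most $C'\varepsilon^{-2}\,n(\log n)^2$ hyperedges, that is, a weighted hypergraph $\tilde H=(V,\tilde E,\tilde w)$ with $\tilde E\subseteq E$, $|\tilde E|\le C'\varepsilon^{-2}n(\log n)^2$ and $|Q_H(x)-Q_{\tilde H}(x)|\le\varepsilon\,Q_H(x)$ for all $x\in\mathbb R^V$. -/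

import Mathlib

open MeasureTheory ProbabilityTheory

/-- The law of a uniformly random sign: mass `1/2` at each of `1` and `-1`. -/
noncomputable def signLaw : Measure ℝ :=
  (2 : ENNReal)⁻¹ • Measure.dirac 1 + (2 : ENNReal)⁻¹ • Measure.dirac (-1)

/-- The norm `‖A‖_{2 → ∞} = max {‖A x‖_∞ : ‖x‖₂ ≤ 1}`. The norm of `Fin m → ℝ` is the
sup norm, and that of `EuclideanSpace ℝ (Fin n)` is the Euclidean norm. -/
noncomputable def twoToInftyNorm {n m : ℕ}
    (A : EuclideanSpace ℝ (Fin n) →ₗ[ℝ] (Fin m → ℝ)) : ℝ :=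
  ⨆ x : Metric.closedBall (0 : EuclideanSpace ℝ (Fin n)) 1, ‖A x‖

/-- The largest of the best Lipschitz constants, with respect to the sup norm, of the functions
`f j` (a real number when every `f j` is Lipschitz). Pairs `z = z'` contribute `0 / 0 = 0`. -/
noncomputable def maxLipConst {m M : ℕ} (f : Fin M → (Fin m → ℝ) → ℝ) : ℝ :=
  ⨆ p : Fin M × (Fin m → ℝ) × (Fin m → ℝ), |f p.1 p.2.1 - f p.1 p.2.2| / ‖p.2.1 - p.2.2‖

/-- A hypergraph on `V` with nonnegative weights on its hyperedges. The values of `weight`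
outside `edges` are irrelevant. -/
structure WeightedHypergraph (V : Type*) where
  edges : Finset (Finset V)
  weight : Finset V → ℝ
  weight_nonneg : ∀ e ∈ edges, 0 ≤ weight e

/-- `Q_e(x)`, the maximum of `(x_u - x_v)²` over pairs of distinct vertices `u, v` of `e`
(and `0` if `e` has fewer than two vertices). -/
noncomputable def edgeEnergy {V : Type*} (e : Finset V) (x : V → ℝ) : ℝ :=
  ⨆ p : {p : V × V // p.1 ∈ e ∧ p.2 ∈ e ∧ p.1 ≠ p.2}, (x p.1.1 - x p.1.2) ^ 2

/-- The energy `Q_H(x) = ∑_{e ∈ E} w_e Q_e(x)`. -/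
noncomputable def WeightedHypergraph.energy {V : Type*} (H : WeightedHypergraph V)
    (x : V → ℝ) : ℝ :=
  ∑ e ∈ H.edges, H.weight e * edgeEnergy e x

/-- `H'` is a spectral `ε`-sparsifier for `H`. -/
def WeightedHypergraph.IsSpectralSparsifier {V : Type*} (H' : WeightedHypergraph V) (ε : ℝ)
    (H : WeightedHypergraph V) : Prop :=
  H'.edges ⊆ H.edges ∧ ∀ x : V → ℝ, |H.energy x - H'.energy x| ≤ ε * H.energy x

/-!
The supremum of the Rademacher process `x ↦ ∑ ε_j f_j(A x)²` is bounded by chaining. Its increments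
are sub-Gaussian, and since `s² - t² = (s - t) (s + t)`, their standard deviation is at most
`2 α S ‖A (x - x')‖_∞`, where `S² = sup ∑ f_j²`. It remains to approximate the points of the Euclidean
ball at all scales `2⁻ᵏ` in the seminorm `max_p |⟪v p, ·⟫|` given by the normalized rows
of `A`, in such a way that `∑ 2⁻ᵏ √(cost at scale k)` is at most a multiple of `√(log m log n)`; the
cost of an approximation is the logarithm of the inverse of a weight, with weights of total mass at
most `1`.

An economical choice is the perceptron. While some row `v p` still distinguishes `x` from its
current approximation `y` by more than `2⁻ᵏ`, replace `y` by `y ± 2⁻ᵏ v p`. This decreases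
`|x - y|²` by at least `4⁻ᵏ`, so the numbers `a_k` of steps at scale `2⁻ᵏ` satisfy
`∑ 4⁻ᵏ a_k ≤ 1` (see `exists_perceptron_codes`). A step costs `O(log m)`, and the Cauchy–Schwarz
inequality over the first `O(log n)` scales bounds their contribution. Below the scale `1 / n`, a
cubic grid is good enough. This is `exists_chaining_net`. The chaining itself
(`integral_iSup_rademacher_sq_le`) uses one random variable that controls all the links
simultaneously (`exists_uniform_increment_bound`).

For the sparsification, maximizing a determinant (`exists_posDef_balanced`) yields a positive
definite form `L`, below the energy up to a small regularization, such that the leverages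
`R_e = max_{u, v ∈ e} (δ_u - δ_v) ⬝ᵥ L⁻¹ (δ_u - δ_v)` satisfy `∑ w_e R_e ≤ n`. After every hyperedge
has been split into copies of about equal `w_e R_e`, the chaining bound, in the coordinates in which
`L` is the Euclidean norm, provides signs such that dropping the copies of one sign and doubling the
weights of the others changes the energy only a little (`exists_half_sum_maxSq`). This is repeated
until only `O(ε⁻² n log² n)` copies are left. The errors of the steps form a geometric progression
(`exists_iterated_half_sum_maxSq`).
-/

/-! ### Rademacher sums -/

instance isProbabilityMeasure_signLaw : IsProbabilityMeasure signLaw :=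
  ⟨by simp [signLaw, ENNReal.inv_two_add_inv_two]⟩

lemma integral_id_signLaw : ∫ x, x ∂signLaw = 0 := by
  rw [signLaw, integral_add_measure, integral_smul_measure, integral_smul_measure]
  · simp
  · exact (integrable_dirac (by simp)).smul_measure (by simp)
  · exact (integrable_dirac (by simp)).smul_measure (by simp)

lemma ae_sign_of_hasLaw {Ω : Type*} [MeasurableSpace Ω] {P : Measure Ω} {X : Ω → ℝ}
    (hX : HasLaw X signLaw P) : ∀ᵐ ω ∂P, X ω = 1 ∨ X ω = -1 := by
  have hm : MeasurableSet {x : ℝ | x = 1 ∨ x = -1} := by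
    have : {x : ℝ | x = 1 ∨ x = -1} = {1, -1} := by ext; simp
    rw [this]; exact (Set.toFinite _).measurableSet
  have h : ∀ᵐ x ∂signLaw, x = 1 ∨ x = -1 := by
    rw [signLaw, ae_add_measure_iff]
    constructor
    · exact Measure.ae_smul_measure ((ae_dirac_iff hm).2 (Or.inl rfl)) _
    · exact Measure.ae_smul_measure ((ae_dirac_iff hm).2 (Or.inr rfl)) _
  rw [← hX.map_eq] at h
  exact ae_of_ae_map hX.aemeasurable h

lemma hasSubgaussianMGF_of_hasLaw_signLaw {Ω : Type*} [MeasurableSpace Ω] {P : Measure Ω}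
    [IsProbabilityMeasure P] {X : Ω → ℝ} (hX : HasLaw X signLaw P) : HasSubgaussianMGF X 1 P := by
  have h := hasSubgaussianMGF_of_mem_Icc_of_integral_eq_zero (a := -1) (b := 1) hX.aemeasurable
    (by filter_upwards [ae_sign_of_hasLaw hX] with ω hω; rcases hω with h | h <;> rw [h] <;> norm_num)
    (by rw [hX.integral_eq]; exact integral_id_signLaw)
  convert h using 1
  ext; norm_num

/-- Exponential moments of a Rademacher sum `∑ b_l ε_l`: it is sub-Gaussian with variance
proxy `∑ b_l ^ 2`. -/
lemma hasSubgaussianMGF_rademacher {J Ω : Type*} [Fintype J] [MeasurableSpace Ω] {P : Measure Ω}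
    [IsProbabilityMeasure P] {ε : J → Ω → ℝ} (hε : ∀ j, HasLaw (ε j) signLaw P)
    (hi : iIndepFun ε P) (b : J → ℝ) :
    HasSubgaussianMGF (fun ω => ∑ l, b l * ε l ω) (∑ l, Real.toNNReal (b l ^ 2)) P := by
  refine HasSubgaussianMGF.sum_of_iIndepFun (X := fun l ω => b l * ε l ω) ?_ fun l _ => ?_
  · exact hi.comp (fun l x => b l * x) fun l => measurable_const_mul _
  · convert (hasSubgaussianMGF_of_hasLaw_signLaw (hε l)).const_mul (b l) using 1
    ext
    rw [Real.coe_toNNReal _ (sq_nonneg _)]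
    exact (mul_one _).symm

/-- Uniform control of the increments of a finite family of Rademacher sums. When the points `b i`
carry costs with `∑ exp (-c i) ≤ 1`, every increment is at most its standard deviation times
`2 * √(c i + c k + 1) + W`, with one random variable `W` of mean at most `2` for all pairs. -/
lemma exists_uniform_increment_bound {J Ω I : Type*} [Fintype J] [MeasurableSpace Ω]
    {P : Measure Ω} [IsProbabilityMeasure P] {ε : J → Ω → ℝ} (hε : ∀ j, HasLaw (ε j) signLaw P)
    (hi : iIndepFun ε P) [Fintype I] (b : I → J → ℝ) (c : I → ℝ) (hc0 : ∀ i, 0 ≤ c i)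
    (hc : ∑ i, Real.exp (-c i) ≤ 1) :
    ∃ W : Ω → ℝ, Integrable W P ∧ ∫ ω, W ω ∂P ≤ 2 ∧ ∀ ω, 0 ≤ W ω ∧ ∀ i k,
      ∑ l, (b i l - b k l) * ε l ω ≤
        Real.sqrt (∑ l, (b i l - b k l) ^ 2) * (2 * Real.sqrt (c i + c k + 1) + W ω) := by
  classical
  set Y : I → I → Ω → ℝ := fun i k ω => ∑ l, (b i l - b k l) * ε l ω with hY
  set d : I → I → ℝ := fun i k => Real.sqrt (∑ l, (b i l - b k l) ^ 2) with hd
  -- the exponents at which the moment generating functions are evaluated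
  set t : I → I → ℝ := fun i k => Real.sqrt (c i + c k + 1) / d i k with ht
  have hd2 : ∀ i k, d i k ^ 2 = ∑ l, (b i l - b k l) ^ 2 := fun i k =>
    Real.sq_sqrt (Finset.sum_nonneg fun l _ => sq_nonneg _)
  have hsub : ∀ i k, HasSubgaussianMGF (Y i k)
      (∑ l, Real.toNNReal ((b i l - b k l) ^ 2)) P := fun i k =>
    hasSubgaussianMGF_rademacher hε hi fun l => b i l - b k l
  set U : I → I → Ω → ℝ := fun i k ω => Real.exp (-c i) * Real.exp (-c k) *
    (Real.exp (-(d i k ^ 2 * t i k ^ 2 / 2)) * Real.exp (t i k * Y i k ω)) with hU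
  have hUint : ∀ i k, Integrable (U i k) P := fun i k =>
    (((hsub i k).integrable_exp_mul (t i k)).const_mul _).const_mul _
  have hU0 : ∀ i k ω, 0 ≤ U i k ω := fun i k ω => by positivity
  have hUle : ∀ i k, ∫ ω, U i k ω ∂P ≤ Real.exp (-c i) * Real.exp (-c k) := by
    intro i k
    simp only [hU]
    rw [integral_const_mul, integral_const_mul]
    have h1 := (hsub i k).mgf_le (t i k)
    rw [mgf] at h1
    have h2 : ((∑ l, Real.toNNReal ((b i l - b k l) ^ 2) : NNReal) : ℝ) = d i k ^ 2 := by
      rw [hd2, NNReal.coe_sum]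
      exact Finset.sum_congr rfl fun l _ => Real.coe_toNNReal _ (sq_nonneg _)
    rw [h2] at h1
    calc _ ≤ Real.exp (-c i) * Real.exp (-c k) * (Real.exp (-(d i k ^ 2 * t i k ^ 2 / 2)) *
          Real.exp (d i k ^ 2 * t i k ^ 2 / 2)) := by gcongr
      _ = _ := by rw [← Real.exp_add (-(d i k ^ 2 * t i k ^ 2 / 2)), neg_add_cancel, Real.exp_zero,
            mul_one]
  -- `W` dominates its own logarithm, and thereby the logarithm of each of the terms `U i k`
  refine ⟨fun ω => 1 + ∑ i, ∑ k, U i k ω, ?_, ?_, fun ω => ⟨?_, fun i k => ?_⟩⟩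
  · exact (integrable_const _).add
      (integrable_finsetSum _ fun i _ => integrable_finsetSum _ fun k _ => hUint i k)
  · rw [integral_add (integrable_const _)
      (integrable_finsetSum _ fun i _ => integrable_finsetSum _ fun k _ => hUint i k),
      integral_finsetSum _ fun i _ => integrable_finsetSum _ fun k _ => hUint i k]
    simp_rw [integral_finsetSum Finset.univ fun k _ => hUint _ k]
    have : ∑ i, ∑ k, ∫ ω, U i k ω ∂P ≤ (∑ i, Real.exp (-c i)) * ∑ k, Real.exp (-c k) := by
      rw [Finset.sum_mul_sum]
      exact Finset.sum_le_sum fun i _ => Finset.sum_le_sum fun k _ => hUle i k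
    have h0 : 0 ≤ ∑ i, Real.exp (-c i) := Finset.sum_nonneg fun i _ => (Real.exp_pos _).le
    simp only [integral_const, probReal_univ, smul_eq_mul, mul_one]
    nlinarith
  · have := Finset.sum_nonneg fun i (_ : i ∈ Finset.univ) =>
      Finset.sum_nonneg fun k (_ : k ∈ Finset.univ) => hU0 i k ω
    show 0 ≤ 1 + ∑ i, ∑ k, U i k ω
    linarith
  · show Y i k ω ≤ d i k * (2 * Real.sqrt (c i + c k + 1) + (1 + ∑ i, ∑ k, U i k ω))
    set Z := 1 + ∑ i, ∑ k, U i k ω with hZ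
    have hUZ : U i k ω ≤ Z := by
      have h1 : U i k ω ≤ ∑ k, U i k ω :=
        Finset.single_le_sum (fun k _ => hU0 i k ω) (Finset.mem_univ k)
      have h2 : ∑ k, U i k ω ≤ ∑ i, ∑ k, U i k ω :=
        Finset.single_le_sum (f := fun i => ∑ k, U i k ω)
          (fun i _ => Finset.sum_nonneg fun k _ => hU0 i k ω) (Finset.mem_univ i)
      linarith
    have hZ1 : 1 ≤ Z := by
      have := Finset.sum_nonneg fun i (_ : i ∈ Finset.univ) =>
        Finset.sum_nonneg fun k (_ : k ∈ Finset.univ) => hU0 i k ω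
      linarith
    rcases (Real.sqrt_nonneg (∑ l, (b i l - b k l) ^ 2)).eq_or_lt with h0 | hpos
    · -- the increment vanishes identically when its standard deviation does
      have hz : ∑ l, (b i l - b k l) ^ 2 = 0 := by
        rw [← hd2, show d i k = 0 from h0.symm]; norm_num
      rw [Finset.sum_eq_zero_iff_of_nonneg fun l _ => sq_nonneg _] at hz
      have hY0 : Y i k ω = 0 := Finset.sum_eq_zero fun l hl => by
        rw [pow_eq_zero_iff two_ne_zero |>.1 (hz l hl), zero_mul]
      rw [hY0, show d i k = 0 from h0.symm, zero_mul]
    · replace hpos : 0 < d i k := hpos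
      set s := Real.sqrt (c i + c k + 1) with hs
      have hs1 : 1 ≤ s := by
        rw [hs, Real.one_le_sqrt]; linarith [hc0 i, hc0 k]
      have hs2 : s ^ 2 = c i + c k + 1 := Real.sq_sqrt (by linarith [hc0 i, hc0 k])
      have htd : t i k * d i k = s := div_mul_cancel₀ _ hpos.ne'
      have hlog : t i k * Y i k ω - d i k ^ 2 * t i k ^ 2 / 2 - c i - c k ≤ Real.log Z := by
        rw [Real.le_log_iff_exp_le (by linarith)]
        refine le_trans (le_of_eq ?_) hUZ
        simp only [hU]
        rw [← Real.exp_add, ← Real.exp_add, ← Real.exp_add]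
        congr 1; ring
      have hlogZ : Real.log Z ≤ Z := by linarith [Real.log_le_sub_one_of_pos (show 0 < Z by linarith)]
      have e1 : d i k ^ 2 * t i k ^ 2 = s ^ 2 := by rw [← htd]; ring
      rw [e1] at hlog
      have e2 : t i k * Y i k ω ≤ s * (2 * s + Z) := by nlinarith
      have e3 : s * Y i k ω ≤ s * (d i k * (2 * s + Z)) := by
        have := mul_le_mul_of_nonneg_left e2 hpos.le
        calc s * Y i k ω = d i k * (t i k * Y i k ω) := by rw [← htd]; ring
          _ ≤ _ := this
          _ = _ := by ring
      exact le_of_mul_le_mul_left e3 (by linarith)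

/-! ### Multi-scale perceptron -/

section Perceptron

variable {E κ : Type*} [NormedAddCommGroup E] [InnerProductSpace ℝ E]

/-- The points `x` and `y` are within `u` of each other for the seminorm `max_p |⟪v p, ·⟫|`. -/
def IsNear (v : κ → E) (u : ℝ) (x y : E) : Prop := ∀ p, |inner ℝ (v p) (x - y)| ≤ u

lemma IsNear.symm {v : κ → E} {u : ℝ} {x y : E} (h : IsNear v u x y) : IsNear v u y x := fun p => by
  rw [← neg_sub, inner_neg_right, abs_neg]; exact h p

lemma IsNear.trans {v : κ → E} {u u' : ℝ} {x y z : E} (h : IsNear v u x y)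
    (h' : IsNear v u' y z) : IsNear v (u + u') x z := fun p => by
  rw [← sub_add_sub_cancel x y z, inner_add_right]
  exact (abs_add_le _ _).trans (add_le_add (h p) (h' p))

lemma isNear_of_norm_le {v : κ → E} (hv : ∀ p, ‖v p‖ ≤ 1) {u : ℝ} {x y : E}
    (h : ‖x - y‖ ≤ u) : IsNear v u x y := fun p =>
  (abs_real_inner_le_norm _ _).trans
    ((mul_le_of_le_one_left (norm_nonneg _) (hv p)).trans h)

/-- One symbol of the code of a point: `none` passes from the scale `2⁻ᵏ` to the next one, and
`some (p, ±)` moves the current approximation by `± 2⁻ᵏ • v p`. A state consists of the current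
approximation and the index `k` of the current scale. -/
noncomputable def perceptronStep (v : κ → E) (s : E × ℕ) : Option (κ × Bool) → E × ℕ
  | none => (s.1, s.2 + 1)
  | some (p, true) => (s.1 + (1 / 2 : ℝ) ^ s.2 • v p, s.2)
  | some (p, false) => (s.1 - (1 / 2 : ℝ) ^ s.2 • v p, s.2)

/-- A violated constraint at scale `2⁻ᵏ` can be used to decrease the squared Euclidean distance
to the target by `4⁻ᵏ`. -/
lemma exists_perceptronStep_of_not_isNear {v : κ → E} (hv : ∀ p, ‖v p‖ ≤ 1) {x y : E} {k : ℕ}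
    (h : ¬ IsNear v ((1 / 2) ^ k) x y) :
    ∃ q y', perceptronStep v (y, k) q = (y', k) ∧
      ‖x - y'‖ ^ 2 + (1 / 4) ^ k ≤ ‖x - y‖ ^ 2 := by
  simp only [IsNear, not_forall, not_le] at h
  obtain ⟨p, hp⟩ := h
  set u : ℝ := (1 / 2) ^ k with hu
  have hu0 : 0 < u := by positivity
  have hu4 : (1 / 4 : ℝ) ^ k = u ^ 2 := by
    rw [hu, ← pow_mul, mul_comm, pow_mul]; norm_num
  have hv2 : ‖u • v p‖ ^ 2 ≤ u ^ 2 := by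
    rw [norm_smul, mul_pow, Real.norm_eq_abs, sq_abs]
    exact mul_le_of_le_one_right (sq_nonneg _) (pow_le_one₀ (norm_nonneg _) (hv p))
  have hin : inner ℝ (x - y) (u • v p) = u * inner ℝ (v p) (x - y) := by
    rw [inner_smul_right, real_inner_comm]
  rw [hu4]
  rcases lt_abs.1 hp with hp | hp
  · refine ⟨some (p, true), _, rfl, ?_⟩
    rw [← sub_sub, norm_sub_sq_real, hin]
    nlinarith
  · refine ⟨some (p, false), _, rfl, ?_⟩
    rw [← sub_add, norm_add_sq_real, hin]
    nlinarith

open Classical in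
/-- The states that are reached from `(0, 0)` by a code of length `l`. -/
noncomputable def perceptronStates [Fintype κ] (v : κ → E) : ℕ → Finset (E × ℕ)
  | 0 => {(0, 0)}
  | l + 1 => (perceptronStates v l ×ˢ (Finset.univ : Finset (Option (κ × Bool)))).image
      fun q => perceptronStep v q.1 q.2

variable [Fintype κ]

lemma card_perceptronStates_le (v : κ → E) (l : ℕ) :
    (perceptronStates v l).card ≤ (2 * Fintype.card κ + 1) ^ l := by
  classical
  induction l with
  | zero => simp [perceptronStates]
  | succ l ih =>
    rw [perceptronStates]
    refine Finset.card_image_le.trans ?_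
    rw [Finset.card_product, pow_succ]
    refine Nat.mul_le_mul ih (le_of_eq ?_)
    simp [mul_comm]

lemma perceptronStep_mem {v : κ → E} {l : ℕ} {s : E × ℕ} (hs : s ∈ perceptronStates v l)
    (q : Option (κ × Bool)) : perceptronStep v s q ∈ perceptronStates v (l + 1) := by
  classical
  rw [perceptronStates]
  exact Finset.mem_image.2 ⟨(s, q), Finset.mem_product.2 ⟨hs, Finset.mem_univ _⟩, rfl⟩

/-- Running the perceptron at a fixed scale: the number of steps is paid for by the decrease of
the squared distance. -/
lemma exists_isNear_perceptronStates {v : κ → E} (hv : ∀ p, ‖v p‖ ≤ 1) (x : E) (k : ℕ) :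
    ∀ {l : ℕ} {y : E}, (y, k) ∈ perceptronStates v l →
    ∃ (a : ℕ) (y' : E), (y', k) ∈ perceptronStates v (l + a) ∧ IsNear v ((1 / 2) ^ k) x y' ∧
      ‖x - y'‖ ^ 2 + a * (1 / 4) ^ k ≤ ‖x - y‖ ^ 2 := by
  have key : ∀ (B : ℕ) {l : ℕ} {y : E}, ‖x - y‖ ^ 2 ≤ B * (1 / 4) ^ k →
      (y, k) ∈ perceptronStates v l →
      ∃ (a : ℕ) (y' : E), (y', k) ∈ perceptronStates v (l + a) ∧ IsNear v ((1 / 2) ^ k) x y' ∧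
      ‖x - y'‖ ^ 2 + a * (1 / 4) ^ k ≤ ‖x - y‖ ^ 2 := by
    intro B
    induction B with
    | zero =>
      intro l y hB hy
      refine ⟨0, y, hy, isNear_of_norm_le hv ?_, by simp⟩
      have : ‖x - y‖ ^ 2 ≤ 0 := by simpa using hB
      rw [pow_eq_zero_iff two_ne_zero |>.1 (le_antisymm this (sq_nonneg _))]
      positivity
    | succ B ih =>
      intro l y hB hy
      by_cases hn : IsNear v ((1 / 2) ^ k) x y
      · exact ⟨0, y, hy, hn, by simp⟩
      · obtain ⟨q, y₁, hq, hd⟩ := exists_perceptronStep_of_not_isNear hv hn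
        have hm := perceptronStep_mem hy q
        rw [hq] at hm
        obtain ⟨a, y', h1, h2, h3⟩ := ih (by push_cast at hB; linarith) hm
        refine ⟨a + 1, y', ?_, h2, ?_⟩
        · rwa [show l + (a + 1) = l + 1 + a by ring]
        · push_cast; linarith
  intro l y hy
  obtain ⟨B, hB⟩ := exists_nat_ge (‖x - y‖ ^ 2 / (1 / 4) ^ k)
  exact key B ((div_le_iff₀ (by positivity)).1 hB) hy

/-- The multi-scale perceptron approximates every point of the unit ball at all scales `2⁻ᵏ`, by
codes whose lengths `l k` satisfy `∑ 4⁻ᵏ * l k ≤ 2`. This square-summability is what the Euclidean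
geometry of the ball contributes to the chaining bound. -/
lemma exists_perceptron_codes {v : κ → E} (hv : ∀ p, ‖v p‖ ≤ 1) {x : E} (hx : ‖x‖ ≤ 1) :
    ∃ (l : ℕ → ℕ) (y : ℕ → E), l 0 = 0 ∧ y 0 = 0 ∧
      (∀ k, (y k, k) ∈ perceptronStates v (l k) ∧ IsNear v ((1 / 2) ^ k) x (y k)) ∧
      ∀ K, ∑ k ∈ Finset.range (K + 1), (1 / 4 : ℝ) ^ k * l k ≤ 2 := by
  have hstep : ∀ (k : ℕ) (s : {s : ℕ × E // (s.2, k) ∈ perceptronStates v s.1}),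
      ∃ s' : {s : ℕ × E // (s.2, k + 1) ∈ perceptronStates v s.1},
        IsNear v ((1 / 2) ^ (k + 1)) x s'.1.2 ∧
        ‖x - s'.1.2‖ ^ 2 + ((s'.1.1 : ℝ) - s.1.1 - 1) * (1 / 4) ^ (k + 1) ≤ ‖x - s.1.2‖ ^ 2 := by
    rintro k ⟨⟨l, y⟩, hs⟩
    obtain ⟨a, y', h1, h2, h3⟩ :=
      exists_isNear_perceptronStates hv x (k + 1) (perceptronStep_mem hs none)
    refine ⟨⟨(l + 1 + a, y'), h1⟩, h2, ?_⟩
    push_cast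
    ring_nf at h3 ⊢
    exact h3
  choose step hstep1 hstep2 using hstep
  let s : ∀ k, {s : ℕ × E // (s.2, k) ∈ perceptronStates v s.1} := fun k =>
    Nat.rec ⟨(0, 0), by simp [perceptronStates]⟩ step k
  have hs : ∀ k, s (k + 1) = step k (s k) := fun k => rfl
  -- at each new scale the potential on the left grows by at most `4 / 3 * 4⁻⁽ᴷ⁺¹⁾`
  have hpot : ∀ K, ∑ k ∈ Finset.range (K + 1), (1 / 4 : ℝ) ^ k * (s k).1.1 +
      1 / 3 * (1 / 4) ^ K * (s K).1.1 + 4 / 3 * ‖x - (s K).1.2‖ ^ 2 ≤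
      16 / 9 - 4 / 9 * (1 / 4) ^ K := by
    intro K
    induction K with
    | zero =>
      have h0 : (s 0).1 = (0, 0) := rfl
      have : ‖x‖ ^ 2 ≤ 1 := pow_le_one₀ (norm_nonneg _) hx
      simp [h0]; linarith
    | succ K ih =>
      rw [Finset.sum_range_succ]
      have := hstep2 K (s K)
      rw [← hs] at this
      rw [pow_succ (1 / 4 : ℝ)] at this ⊢
      linarith
  refine ⟨fun k => (s k).1.1, fun k => (s k).1.2, rfl, rfl, fun k => ⟨(s k).2, ?_⟩, fun K => ?_⟩
  · cases k with
    | zero => exact isNear_of_norm_le hv (by simpa [show (s 0).1 = (0, 0) from rfl] using hx)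
    | succ k => exact hstep1 k (s k)
  · have := hpot K
    have h1 : 0 ≤ 1 / 3 * (1 / 4 : ℝ) ^ K * (s K).1.1 := by positivity
    have h2 : (0 : ℝ) ≤ 4 / 9 * (1 / 4) ^ K := by positivity
    have h3 := sq_nonneg ‖x - (s K).1.2‖
    show ∑ k ∈ Finset.range (K + 1), (1 / 4 : ℝ) ^ k * (s k).1.1 ≤ 2
    linarith

end Perceptron

/-! ### Nets for chaining in the Euclidean ball -/

lemma sum_geometric_le (r : ℝ) (h0 : 0 ≤ r) (h1 : r < 1) (N : ℕ) :
    ∑ k ∈ Finset.range N, r ^ k ≤ (1 - r)⁻¹ :=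
  (summable_geometric_of_lt_one h0 h1).sum_le_tsum _ (fun k _ => pow_nonneg h0 k) |>.trans_eq
    (tsum_geometric_of_lt_one h0 h1)

/-- The point of the cubic grid of mesh `1 / q` with integer coordinates `z`, shifted so that the
grid covers the cube `[-1, 1]^ι`. -/
noncomputable def gridPoint {ι : Type*} (q : ℕ) (z : ι → Fin (2 * q + 1)) : EuclideanSpace ℝ ι :=
  WithLp.toLp 2 fun i => ((z i : ℕ) - q : ℝ) / q

lemma exists_gridPoint_near {ι : Type*} [Fintype ι] [Nonempty ι] (k : ℕ) {x : EuclideanSpace ℝ ι}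
    (hx : ‖x‖ ≤ 1) : ∃ z, ‖x - gridPoint (Fintype.card ι * 2 ^ k) z‖ ≤ (1 / 2) ^ k := by
  set n := Fintype.card ι with hn
  have hn1 : (1 : ℝ) ≤ n := by exact_mod_cast Fintype.card_pos (α := ι)
  set q := n * 2 ^ k with hq
  have hq' : (q : ℝ) = n * 2 ^ k := by rw [hq]; push_cast; ring
  have hq0 : (0 : ℝ) < q := by rw [hq']; positivity
  have hxi : ∀ i, |x i| ≤ 1 := fun i => (PiLp.norm_apply_le x i).trans hx
  have hz : ∀ i, ∃ z : Fin (2 * q + 1), |x i - ((z : ℕ) - q : ℝ) / q| ≤ 1 / q := by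
    intro i
    have h := abs_le.1 (hxi i)
    have hnn : 0 ≤ (x i + 1) * q := mul_nonneg (by linarith) hq0.le
    refine ⟨⟨⌊(x i + 1) * q⌋₊, ?_⟩, ?_⟩
    · have : ⌊(x i + 1) * q⌋₊ ≤ 2 * q := by
        refine Nat.floor_le_of_le ?_
        push_cast
        exact mul_le_mul_of_nonneg_right (by linarith) hq0.le
      omega
    · have h1 := Nat.floor_le hnn
      have h2 := Nat.lt_floor_add_one ((x i + 1) * q)
      have e : x i - ((⌊(x i + 1) * q⌋₊ : ℝ) - q) / q = ((x i + 1) * q - ⌊(x i + 1) * q⌋₊) / q := by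
        field_simp; ring
      show |x i - ((⌊(x i + 1) * q⌋₊ : ℝ) - q) / q| ≤ 1 / q
      rw [e, abs_div, abs_of_pos hq0, abs_of_nonneg (by linarith)]
      gcongr
      linarith
  choose z hz using hz
  refine ⟨z, ?_⟩
  have hsq : ‖x - gridPoint q z‖ ^ 2 ≤ ((1 / 2) ^ k) ^ 2 := by
    rw [EuclideanSpace.norm_sq_eq]
    calc ∑ i, ‖(x - gridPoint q z) i‖ ^ 2 ≤ ∑ _i : ι, (1 / (q : ℝ)) ^ 2 := by
          refine Finset.sum_le_sum fun i _ => pow_le_pow_left₀ (norm_nonneg _) (hz i) 2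
      _ = n * (1 / (q : ℝ)) ^ 2 := by simp [hn]
      _ ≤ n * (n * (1 / (q : ℝ)) ^ 2) := le_mul_of_one_le_left (by positivity) hn1
      _ = ((1 / 2) ^ k) ^ 2 := by
        rw [hq', one_div_pow (2 : ℝ)]; field_simp
  exact (pow_le_pow_iff_left₀ (norm_nonneg _) (by positivity) two_ne_zero).1 hsq

/-- Beyond the scale `2⁻ᴷ ≤ 1 / n` the costs of the cubic grids are summable. -/
lemma grid_cost_le {n K k : ℕ} (hn : 1 ≤ n) (hK : n ≤ 2 ^ K) (hk : K ≤ k) :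
    (1 / 2 : ℝ) ^ k * Real.sqrt (n * Real.log (2 * (n * 2 ^ k : ℕ) + 1) + (k + 2) * Real.log 2) ≤
      5 * (4 / 5) ^ k := by
  have hlog2 : Real.log 2 ≤ 1 := by linarith [Real.log_two_lt_d9]
  have hn1 : (1 : ℝ) ≤ n := by exact_mod_cast hn
  have hnk : (n : ℝ) ≤ 2 ^ k := by
    exact_mod_cast hK.trans (Nat.pow_le_pow_right (by norm_num) hk)
  have h2k : (1 : ℝ) ≤ 2 ^ k := one_le_pow₀ (by norm_num)
  have hlog : Real.log (2 * (n * 2 ^ k : ℕ) + 1) ≤ 2 * k + 2 := by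
    have : (2 * (n * 2 ^ k : ℕ) + 1 : ℝ) ≤ 2 ^ (2 * k + 2) := by
      push_cast
      rw [pow_add, pow_mul']
      nlinarith
    calc _ ≤ Real.log (2 ^ (2 * k + 2)) := Real.log_le_log (by positivity) this
      _ = (2 * k + 2 : ℕ) * Real.log 2 := by rw [Real.log_pow]
      _ ≤ (2 * k + 2 : ℕ) * 1 := by gcongr
      _ = _ := by push_cast; ring
  have hcost : n * Real.log (2 * (n * 2 ^ k : ℕ) + 1) + (k + 2) * Real.log 2 ≤
      2 ^ k * (5 * (k + 1)) := by
    have hk0 : (0 : ℝ) ≤ k := k.cast_nonneg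
    have hlog0 : 0 ≤ Real.log (2 * (n * 2 ^ k : ℕ) + 1) := by
      have : (0 : ℝ) ≤ (n * 2 ^ k : ℕ) := Nat.cast_nonneg _
      exact Real.log_nonneg (by linarith)
    calc _ ≤ (2 : ℝ) ^ k * (2 * k + 2) + (k + 2) * 1 := by gcongr
      _ ≤ _ := by nlinarith
  have hbern : (k + 1 : ℝ) ≤ 5 * (32 / 25) ^ k := by
    have := one_add_mul_le_pow (show (-2 : ℝ) ≤ 7 / 25 by norm_num) k
    rw [show (1 + 7 / 25 : ℝ) = 32 / 25 by norm_num] at this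
    have hk0 : (0 : ℝ) ≤ k := k.cast_nonneg
    linarith
  have hsq : 2 ^ k * (5 * (k + 1)) ≤ ((2 : ℝ) ^ k * (5 * (4 / 5) ^ k)) ^ 2 := by
    calc (2 : ℝ) ^ k * (5 * (k + 1)) ≤ 2 ^ k * (5 * (5 * (32 / 25) ^ k)) := by gcongr
      _ = 25 * (2 * (32 / 25)) ^ k := by rw [mul_pow]; ring
      _ = _ := by
        rw [show (2 : ℝ) * (32 / 25) = (2 * (4 / 5)) ^ 2 by norm_num, ← pow_mul, mul_comm 2 k,
          pow_mul, mul_pow (2 : ℝ) (4 / 5) k]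
        ring
  have hs : Real.sqrt (n * Real.log (2 * (n * 2 ^ k : ℕ) + 1) + (k + 2) * Real.log 2) ≤
      2 ^ k * (5 * (4 / 5) ^ k) := Real.sqrt_le_iff.2 ⟨by positivity, hcost.trans hsq⟩
  calc _ ≤ (1 / 2 : ℝ) ^ k * (2 ^ k * (5 * (4 / 5) ^ k)) := by gcongr
    _ = _ := by rw [← mul_assoc, ← mul_pow]; norm_num

/-- The costs of the perceptron codes down to scale `2⁻ᴷ`, by the Cauchy–Schwarz inequality. -/
lemma perceptron_cost_le (l : ℕ → ℕ) (K : ℕ)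
    (hl : ∑ k ∈ Finset.range (K + 1), (1 / 4 : ℝ) ^ k * l k ≤ 2) {b : ℝ} (hb : 0 ≤ b) :
    ∑ k ∈ Finset.range (K + 1), (1 / 2 : ℝ) ^ k * Real.sqrt ((l k + 1) * b) ≤
      Real.sqrt ((K + 1) * (4 * b)) := by
  refine Real.le_sqrt_of_sq_le ?_
  calc (∑ k ∈ Finset.range (K + 1), (1 / 2 : ℝ) ^ k * Real.sqrt ((l k + 1) * b)) ^ 2
      ≤ (Finset.range (K + 1)).card *
        ∑ k ∈ Finset.range (K + 1), ((1 / 2 : ℝ) ^ k * Real.sqrt ((l k + 1) * b)) ^ 2 :=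
        sq_sum_le_card_mul_sum_sq
    _ = (K + 1) * ∑ k ∈ Finset.range (K + 1), ((1 / 4 : ℝ) ^ k * l k + (1 / 4) ^ k) * b := by
        rw [Finset.card_range]; push_cast
        congr 1
        refine Finset.sum_congr rfl fun k _ => ?_
        rw [mul_pow, Real.sq_sqrt (by positivity), ← pow_mul, mul_comm k 2, pow_mul]
        norm_num; ring
    _ ≤ (K + 1) * (4 * b) := by
        rw [← Finset.sum_mul, Finset.sum_add_distrib]
        have := sum_geometric_le (1 / 4) (by norm_num) (by norm_num) (K + 1)
        norm_num at this hl ⊢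
        gcongr
        linarith

lemma one_half_le_sqrt_log_mul_log {m n : ℕ} (hm : 2 ≤ m) (hn : 2 ≤ n) :
    1 / 2 ≤ Real.sqrt (Real.log m * Real.log n) := by
  have hm' : Real.log 2 ≤ Real.log m := Real.log_le_log (by norm_num) (by exact_mod_cast hm)
  have hn' : Real.log 2 ≤ Real.log n := Real.log_le_log (by norm_num) (by exact_mod_cast hn)
  have := Real.log_two_gt_d9
  exact Real.le_sqrt_of_sq_le (by nlinarith)

/-- A finite family of points of the Euclidean space with costs `c i`, and for every point of the
unit ball a sequence of its approximations at the scales `2⁻ᵏ`, the total cost of which is at most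
`√(log m * log n)` up to a constant. -/
theorem exists_chaining_net.{u, w} {ι : Type u} {κ : Type w} [Fintype ι] [Fintype κ]
    (hn : 2 ≤ Fintype.card ι) (hm : 2 ≤ Fintype.card κ) {v : κ → EuclideanSpace ℝ ι}
    (hv : ∀ p, ‖v p‖ ≤ 1) (K' : ℕ) :
    ∃ (I : Type u) (_ : Fintype I) (y : I → EuclideanSpace ℝ ι) (lev : I → ℕ) (c : I → ℝ) (i₀ : I),
      (∀ i, 0 ≤ c i) ∧ ∑ i, Real.exp (-c i) ≤ 1 ∧
      ∀ x : EuclideanSpace ℝ ι, ‖x‖ ≤ 1 → ∃ i : ℕ → I, i 0 = i₀ ∧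
        (∀ k ≤ K', lev (i k) = k ∧ IsNear v ((1 / 2) ^ k) x (y (i k))) ∧
        ∑ k ∈ Finset.range (K' + 1), (1 / 2 : ℝ) ^ k * Real.sqrt (c (i k)) ≤
          60 * Real.sqrt (Real.log (Fintype.card κ) * Real.log (Fintype.card ι)) := by
  classical
  set n := Fintype.card ι with hn_def
  set m := Fintype.card κ with hm_def
  have : Nonempty ι := Fintype.card_pos_iff.1 (by omega)
  -- perceptron codes serve down to the scale `2⁻ᴷ ≤ 1 / n`, and cubic grids below it
  set K := Nat.clog 2 n with hK_def
  have hK : n ≤ 2 ^ K := Nat.le_pow_clog (by norm_num) n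
  set L := 2 * 4 ^ K + 1 with hL
  set b : ℝ := Real.log (4 * m + 2) with hb
  have hm2 : (2 : ℝ) ≤ m := by exact_mod_cast hm
  have hn2 : (2 : ℝ) ≤ n := by exact_mod_cast hn
  have hb0 : 0 ≤ b := Real.log_nonneg (by linarith)
  let I := (Σ l : Fin L, {s // s ∈ perceptronStates v l}) ⊕
    (Σ k : Fin (K' + 1), (ι → Fin (2 * (n * 2 ^ (k : ℕ)) + 1)))
  let y : I → EuclideanSpace ℝ ι := Sum.elim (fun s => s.2.1.1) fun s => gridPoint _ s.2
  let lev : I → ℕ := Sum.elim (fun s => s.2.1.2) fun s => s.1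
  let c : I → ℝ := Sum.elim (fun s => ((s.1 : ℕ) + 1) * b)
    fun s => n * Real.log (2 * (n * 2 ^ (s.1 : ℕ) : ℕ) + 1) + ((s.1 : ℕ) + 2) * Real.log 2
  let i₀ : I := Sum.inl ⟨⟨0, by omega⟩, ⟨(0, 0), by simp [perceptronStates]⟩⟩
  refine ⟨I, inferInstance, y, lev, c, i₀, ?_, ?_, ?_⟩
  · rintro (s | s)
    · exact mul_nonneg (by positivity) hb0
    · have : 0 ≤ Real.log (2 * (n * 2 ^ (s.1 : ℕ) : ℕ) + 1) :=
        Real.log_nonneg (by have : (0 : ℝ) ≤ (n * 2 ^ (s.1 : ℕ) : ℕ) := Nat.cast_nonneg _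
                            linarith)
      have : 0 ≤ Real.log 2 := Real.log_nonneg (by norm_num)
      show 0 ≤ n * Real.log (2 * (n * 2 ^ (s.1 : ℕ) : ℕ) + 1) + ((s.1 : ℕ) + 2) * Real.log 2
      positivity
  · rw [Fintype.sum_sum_type, Fintype.sum_sigma, Fintype.sum_sigma]
    have h1 : ∑ l : Fin L, ∑ s : {s // s ∈ perceptronStates v l},
        Real.exp (-c (Sum.inl ⟨l, s⟩)) ≤ 1 / 2 := by
      calc _ ≤ ∑ l : Fin L, (1 / 2 : ℝ) ^ (l : ℕ) * (1 / 4) := by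
            refine Finset.sum_le_sum fun l _ => ?_
            show ∑ s : {s // s ∈ perceptronStates v l}, Real.exp (-(((l : ℕ) + 1) * b)) ≤ _
            rw [Finset.sum_const, Finset.card_univ, Fintype.card_coe, nsmul_eq_mul]
            have e : Real.exp (-(((l : ℕ) + 1) * b)) = ((4 * m + 2 : ℝ) ^ ((l : ℕ) + 1))⁻¹ := by
              rw [Real.exp_neg, ← Nat.cast_succ, Real.exp_nat_mul, hb,
                Real.exp_log (by positivity)]
            have hc : ((perceptronStates v l).card : ℝ) ≤ (2 * m + 1) ^ (l : ℕ) := by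
              exact_mod_cast card_perceptronStates_le v l
            rw [e]
            calc _ ≤ (2 * m + 1 : ℝ) ^ (l : ℕ) * ((4 * m + 2 : ℝ) ^ ((l : ℕ) + 1))⁻¹ := by gcongr
              _ = (1 / 2 : ℝ) ^ (l : ℕ) * (1 / (4 * m + 2)) := by
                rw [show (4 * m + 2 : ℝ) = 2 * (2 * m + 1) by ring, pow_succ, mul_pow, div_pow]
                field_simp; simp
              _ ≤ _ := by gcongr; linarith
        _ = (∑ l ∈ Finset.range L, (1 / 2 : ℝ) ^ l) * (1 / 4) := by
            rw [Finset.sum_mul, Finset.sum_range]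
        _ ≤ 2 * (1 / 4) := by
            gcongr
            exact (sum_geometric_le _ (by norm_num) (by norm_num) _).trans (by norm_num)
        _ = _ := by norm_num
    have h2 : ∑ k : Fin (K' + 1), ∑ s : (ι → Fin (2 * (n * 2 ^ (k : ℕ)) + 1)),
        Real.exp (-c (Sum.inr ⟨k, s⟩)) ≤ 1 / 2 := by
      calc _ = ∑ k : Fin (K' + 1), (1 / 2 : ℝ) ^ (k : ℕ) * (1 / 4) := by
            refine Finset.sum_congr rfl fun k _ => ?_
            show ∑ s : (ι → Fin (2 * (n * 2 ^ (k : ℕ)) + 1)), Real.exp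
              (-(n * Real.log (2 * (n * 2 ^ (k : ℕ) : ℕ) + 1) + ((k : ℕ) + 2) * Real.log 2)) = _
            rw [Finset.sum_const, Finset.card_univ, Fintype.card_fun, Fintype.card_fin,
              nsmul_eq_mul, neg_add, Real.exp_add, Real.exp_neg, Real.exp_neg, Real.exp_nat_mul,
              Real.exp_log (by positivity), ← hn_def, ← Nat.cast_ofNat (R := ℝ) (n := 2),
              ← Nat.cast_add, Real.exp_nat_mul, Nat.cast_ofNat, Real.exp_log (by norm_num), ← mul_assoc]
            push_cast
            rw [mul_inv_cancel₀ (by positivity), pow_add, one_div, inv_pow]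
            norm_num [mul_comm]
        _ = (∑ l ∈ Finset.range (K' + 1), (1 / 2 : ℝ) ^ l) * (1 / 4) := by
            rw [Finset.sum_mul, Finset.sum_range]
        _ ≤ 2 * (1 / 4) := by
            gcongr
            exact (sum_geometric_le _ (by norm_num) (by norm_num) _).trans (by norm_num)
        _ = _ := by norm_num
    linarith
  · intro x hx
    obtain ⟨l, p, hl0, hp0, hp, hl⟩ := exists_perceptron_codes hv hx
    have hlL : ∀ k ≤ K, l k < L := by
      intro k hk
      have h1 : (1 / 4 : ℝ) ^ k * l k ≤ 2 :=
        (Finset.single_le_sum (f := fun k => (1 / 4 : ℝ) ^ k * l k) (fun k _ => by positivity)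
          (Finset.self_mem_range_succ k)).trans (hl k)
      have h2 : (l k : ℝ) ≤ 2 * 4 ^ k := by
        rw [one_div, inv_pow, inv_mul_le_iff₀ (by positivity)] at h1; linarith
      have h3 : l k ≤ 2 * 4 ^ k := by exact_mod_cast h2
      have h4 : 4 ^ k ≤ 4 ^ K := Nat.pow_le_pow_right (by norm_num) hk
      omega
    have hex : ∀ k, ∃ i : I, (k = 0 → i = i₀) ∧ (k ≤ K' →
        (lev i = k ∧ IsNear v ((1 / 2) ^ k) x (y i)) ∧
        (1 / 2 : ℝ) ^ k * Real.sqrt (c i) ≤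
          (if k ≤ K then (1 / 2 : ℝ) ^ k * Real.sqrt ((l k + 1) * b) else 0) +
            5 * (4 / 5) ^ k) := by
      intro k
      by_cases hkK : k ≤ K
      · refine ⟨Sum.inl ⟨⟨l k, hlL k hkK⟩, ⟨(p k, k), (hp k).1⟩⟩, ?_, fun _ => ⟨⟨rfl, (hp k).2⟩, ?_⟩⟩
        · rintro rfl
          show (Sum.inl _ : I) = Sum.inl _
          congr 1
          have : (⟨l 0, hlL 0 hkK⟩ : Fin L) = ⟨0, by omega⟩ := by simp [hl0]
          refine Sigma.ext this ?_
          refine (Subtype.heq_iff_coe_eq fun s => ?_).2 ?_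
          · simp [hl0]
          · simp [hp0]
        · rw [if_pos hkK]
          show _ * Real.sqrt ((l k + 1) * b) ≤ _
          have : (0 : ℝ) ≤ 5 * (4 / 5) ^ k := by positivity
          linarith
      · have hk0 : k ≠ 0 := by omega
        by_cases hkK' : k ≤ K'
        · obtain ⟨z, hz⟩ := exists_gridPoint_near k hx
          refine ⟨Sum.inr ⟨⟨k, by omega⟩, z⟩, fun h => absurd h hk0, fun _ =>
            ⟨⟨rfl, isNear_of_norm_le hv hz⟩, ?_⟩⟩
          rw [if_neg hkK, zero_add]
          exact grid_cost_le (by omega) hK (by omega)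
        · exact ⟨i₀, fun h => absurd h hk0, fun h => absurd h hkK'⟩
    choose i hi0 hi using hex
    refine ⟨i, hi0 0 rfl, fun k hk => (hi k hk).1, ?_⟩
    have hlogn : (K + 1 : ℝ) ≤ 5 * Real.log n := by
      have hK1 : 1 ≤ K := Nat.clog_pos (by norm_num) hn
      have h1 : 2 ^ (K - 1) < n := Nat.pow_pred_clog_lt_self (by norm_num) (by omega)
      have h2 : ((2 : ℝ) ^ (K - 1)) ≤ n := by exact_mod_cast h1.le
      have h3 := Real.log_le_log (by positivity) h2
      rw [Real.log_pow, Nat.cast_sub hK1] at h3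
      have h4 := Real.log_two_gt_d9
      have h5 : Real.log 2 ≤ Real.log n := Real.log_le_log (by norm_num) hn2
      push_cast at h3
      have hK1' : (1 : ℝ) ≤ K := by exact_mod_cast hK1
      nlinarith
    have hlogm : b ≤ 4 * Real.log m := by
      have : (4 * m + 2 : ℝ) ≤ m ^ 4 := by nlinarith [sq_nonneg ((m : ℝ) - 2), sq_nonneg ((m : ℝ)^2 - 4)]
      calc b ≤ Real.log (m ^ 4) := Real.log_le_log (by positivity) this
        _ = _ := by rw [Real.log_pow]; norm_num
    have hlogm0 : 0 ≤ Real.log m := Real.log_nonneg (by linarith)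
    have hlogn0 : 0 ≤ Real.log n := Real.log_nonneg (by linarith)
    set s := Real.sqrt (Real.log m * Real.log n) with hs
    have hs2 : 1 / 2 ≤ s := one_half_le_sqrt_log_mul_log hm hn
    have hA : ∑ k ∈ Finset.range (K + 1), (1 / 2 : ℝ) ^ k * Real.sqrt ((l k + 1) * b) ≤ 10 * s := by
      refine (perceptron_cost_le l K (hl K) hb0).trans ?_
      rw [Real.sqrt_le_left (by positivity), mul_pow, Real.sq_sqrt (by positivity)]
      calc (K + 1 : ℝ) * (4 * b) ≤ (5 * Real.log n) * (4 * (4 * Real.log m)) := by gcongr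
        _ ≤ _ := by nlinarith [mul_nonneg hlogm0 hlogn0]
    have hB : ∑ k ∈ Finset.range (K' + 1), (5 : ℝ) * (4 / 5) ^ k ≤ 25 := by
      rw [← Finset.mul_sum]
      have := sum_geometric_le (4 / 5) (by norm_num) (by norm_num) (K' + 1)
      norm_num at this ⊢
      linarith
    calc _ ≤ ∑ k ∈ Finset.range (K' + 1),
          ((if k ≤ K then (1 / 2 : ℝ) ^ k * Real.sqrt ((l k + 1) * b) else 0) +
            5 * (4 / 5) ^ k) :=
          Finset.sum_le_sum fun k hk => (hi k (by simpa [Nat.lt_succ_iff] using hk)).2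
      _ ≤ ∑ k ∈ Finset.range (K + 1), (1 / 2 : ℝ) ^ k * Real.sqrt ((l k + 1) * b) + 25 := by
          rw [Finset.sum_add_distrib, ← Finset.sum_filter]
          refine add_le_add (Finset.sum_le_sum_of_subset_of_nonneg ?_ fun k _ _ => by positivity) hB
          intro k hk
          simp only [Finset.mem_filter, Finset.mem_range] at hk ⊢
          omega
      _ ≤ 60 * s := by linarith

/-! ### Suprema of Rademacher processes of squares -/

section Integrability

variable {J T : Type*} [Fintype J] {h : T → J → ℝ} {B : ℝ}

lemma bddAbove_range_sum_mul (hB : ∀ t j, |h t j| ≤ B) (e : J → ℝ) :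
    BddAbove (Set.range fun t => ∑ j, e j * h t j) := by
  refine ⟨∑ j, |e j| * B, ?_⟩
  rintro _ ⟨t, rfl⟩
  refine Finset.sum_le_sum fun j _ => (le_abs_self _).trans ?_
  rw [abs_mul]
  exact mul_le_mul_of_nonneg_left (hB t j) (abs_nonneg _)

lemma iSup_sum_mul_le_add (hB0 : 0 ≤ B) (hB : ∀ t j, |h t j| ≤ B) (e e' : J → ℝ) :
    (⨆ t, ∑ j, e j * h t j) ≤ (⨆ t, ∑ j, e' j * h t j) + ∑ j, |e j - e' j| * B := by
  rcases isEmpty_or_nonempty T with hT | hT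
  · simp only [Real.iSup_of_isEmpty, zero_add]
    exact Finset.sum_nonneg fun j _ => mul_nonneg (abs_nonneg _) hB0
  · refine ciSup_le fun t => ?_
    have h1 := le_ciSup (bddAbove_range_sum_mul hB e') t
    have h2 : ∑ j, e j * h t j ≤ ∑ j, e' j * h t j + ∑ j, |e j - e' j| * B := by
      rw [← Finset.sum_add_distrib]
      refine Finset.sum_le_sum fun j _ => ?_
      have h3 : (e j - e' j) * h t j ≤ |e j - e' j| * B := (le_abs_self _).trans (by
        rw [abs_mul]; exact mul_le_mul_of_nonneg_left (hB t j) (abs_nonneg _))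
      linarith
    linarith

lemma continuous_iSup_sum_mul (hB0 : 0 ≤ B) (hB : ∀ t j, |h t j| ≤ B) :
    Continuous fun e : J → ℝ => ⨆ t, ∑ j, e j * h t j := by
  refine LipschitzWith.continuous (K := ⟨Fintype.card J * B, by positivity⟩)
    (LipschitzWith.of_le_add_mul _ fun e e' => ?_)
  refine (iSup_sum_mul_le_add hB0 hB e e').trans (add_le_add_right ?_ _)
  calc ∑ j, |e j - e' j| * B ≤ ∑ _j : J, dist e e' * B := by
        refine Finset.sum_le_sum fun j _ => mul_le_mul_of_nonneg_right ?_ hB0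
        exact dist_le_pi_dist e e' j
    _ = Fintype.card J * B * dist e e' := by
        rw [Finset.sum_const, Finset.card_univ, nsmul_eq_mul]; ring

/-- The supremum of a bounded Rademacher process is integrable, whatever the index set: it is a
continuous function of the vector of signs. -/
lemma integrable_iSup_rademacher {Ω : Type*} [MeasurableSpace Ω] {P : Measure Ω}
    [IsProbabilityMeasure P] {ε : J → Ω → ℝ} (hε : ∀ j, HasLaw (ε j) signLaw P)
    (hB0 : 0 ≤ B) (hB : ∀ t j, |h t j| ≤ B) :
    Integrable (fun ω => ⨆ t, ∑ j, ε j ω * h t j) P := by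
  refine Integrable.of_bound (C := ∑ _j : J, B) ?_ ?_
  · exact (continuous_iSup_sum_mul hB0 hB).comp_aestronglyMeasurable
      (aemeasurable_pi_lambda _ fun j => (hε j).aemeasurable).aestronglyMeasurable
  · filter_upwards [ae_all_iff.2 fun j => ae_sign_of_hasLaw (hε j)] with ω hω
    have habs : ∀ j, |ε j ω| = 1 := fun j => by rcases hω j with h | h <;> simp [h]
    have h1 := iSup_sum_mul_le_add hB0 hB (fun j => ε j ω) 0
    have h2 := iSup_sum_mul_le_add hB0 hB 0 (fun j => ε j ω)
    simp [habs] at h1 h2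
    rw [Real.norm_eq_abs, abs_le]
    simp only [Finset.sum_const, Finset.card_univ, nsmul_eq_mul]
    constructor <;> linarith

end Integrability

lemma integral_rademacher_sum {J Ω : Type*} [Fintype J] [MeasurableSpace Ω] {P : Measure Ω}
    [IsProbabilityMeasure P] {ε : J → Ω → ℝ} (hε : ∀ j, HasLaw (ε j) signLaw P) (b : J → ℝ) :
    Integrable (fun ω => ∑ j, ε j ω * b j) P ∧ ∫ ω, ∑ j, ε j ω * b j ∂P = 0 := by
  have hint : ∀ j, Integrable (fun ω => ε j ω * b j) P := fun j =>
    (hasSubgaussianMGF_of_hasLaw_signLaw (hε j)).integrable.mul_const _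
  refine ⟨integrable_finsetSum _ fun j _ => hint j, ?_⟩
  rw [integral_finsetSum _ fun j _ => hint j]
  refine Finset.sum_eq_zero fun j _ => ?_
  rw [integral_mul_const, (hε j).integral_eq, integral_id_signLaw, zero_mul]

/-- The standard deviation of the increments of `∑ ε_j g_j ^ 2`. -/
lemma sqrt_sum_sq_sub_sq_le {J : Type*} [Fintype J] {p q : J → ℝ} {r S : ℝ} (hr : 0 ≤ r)
    (hS : 0 ≤ S) (h : ∀ j, |p j - q j| ≤ r) (hp : ∑ j, p j ^ 2 ≤ S ^ 2)
    (hq : ∑ j, q j ^ 2 ≤ S ^ 2) :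
    Real.sqrt (∑ j, (p j ^ 2 - q j ^ 2) ^ 2) ≤ 2 * r * S := by
  rw [Real.sqrt_le_left (by positivity)]
  calc ∑ j, (p j ^ 2 - q j ^ 2) ^ 2 ≤ ∑ j, r ^ 2 * (2 * p j ^ 2 + 2 * q j ^ 2) := by
        refine Finset.sum_le_sum fun j _ => ?_
        have h1 : (p j - q j) ^ 2 ≤ r ^ 2 := sq_le_sq' (abs_le.1 (h j)).1 (abs_le.1 (h j)).2
        have h2 : (p j + q j) ^ 2 ≤ 2 * p j ^ 2 + 2 * q j ^ 2 := by nlinarith [sq_nonneg (p j - q j)]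
        calc (p j ^ 2 - q j ^ 2) ^ 2 = (p j - q j) ^ 2 * (p j + q j) ^ 2 := by ring
          _ ≤ _ := mul_le_mul h1 h2 (sq_nonneg _) (sq_nonneg _)
    _ = r ^ 2 * (2 * ∑ j, p j ^ 2 + 2 * ∑ j, q j ^ 2) := by
        rw [← Finset.mul_sum, Finset.sum_add_distrib, ← Finset.mul_sum, ← Finset.mul_sum]
    _ ≤ r ^ 2 * (2 * S ^ 2 + 2 * S ^ 2) := by gcongr
    _ = (2 * r * S) ^ 2 := by ring

/-- Chaining bound for the Rademacher process `t ↦ ∑ ε_j g_j(t) ^ 2` over a set parametrized by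
points `a t` of the Euclidean unit ball, when the functions `g j` are `α`-Lipschitz with respect
to the seminorm `max_p |⟪v p, ·⟫|`. -/
theorem integral_iSup_rademacher_sq_le {ι κ J T Ω : Type*} [Fintype ι] [Fintype κ] [Fintype J]
    [Nonempty T] (hn : 2 ≤ Fintype.card ι) (hm : 2 ≤ Fintype.card κ)
    {v : κ → EuclideanSpace ℝ ι} (hv : ∀ p, ‖v p‖ ≤ 1)
    {a : T → EuclideanSpace ℝ ι} (ha : ∀ t, ‖a t‖ ≤ 1) {g : J → T → ℝ} {α S : ℝ} (hα : 0 ≤ α)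
    (hS : 0 ≤ S) (hg : ∀ j s t u, 0 ≤ u → IsNear v u (a s) (a t) → |g j s - g j t| ≤ α * u)
    (hgS : ∀ t, ∑ j, g j t ^ 2 ≤ S ^ 2)
    [MeasurableSpace Ω] {P : Measure Ω} [IsProbabilityMeasure P] {ε : J → Ω → ℝ}
    (hε : ∀ j, HasLaw (ε j) signLaw P) (hi : iIndepFun ε P) :
    ∫ ω, (⨆ t, ∑ j, ε j ω * g j t ^ 2) ∂P ≤
      2300 * Real.sqrt (Real.log (Fintype.card κ) * Real.log (Fintype.card ι)) * α * S := by
  classical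
  set A := Real.sqrt (Real.log (Fintype.card κ) * Real.log (Fintype.card ι)) with hA
  have hA2 : 1 / 2 ≤ A := one_half_le_sqrt_log_mul_log hm hn
  have hB : ∀ t j, |g j t ^ 2| ≤ S ^ 2 := fun t j => by
    rw [abs_of_nonneg (sq_nonneg _)]
    exact (Finset.single_le_sum (f := fun j => g j t ^ 2) (fun j _ => sq_nonneg _)
      (Finset.mem_univ j)).trans (hgS t)
  -- the error of the chaining at level `K`, which tends to `0`
  have main : ∀ K : ℕ, ∫ ω, (⨆ t, ∑ j, ε j ω * g j t ^ 2) ∂P ≤ 2300 * A * α * S +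
      Real.sqrt (Fintype.card J) * (4 * α * S) * (1 / 2) ^ K := by
    intro K
    obtain ⟨I, _, y, lev, c, i₀, hc0, hc1, hnet⟩ := exists_chaining_net hn hm hv K
    -- the links of the chain have to lie in `T`, since `g` is only controlled there
    let rep : I → T := fun i =>
      if h : ∃ t, IsNear v ((1 / 2) ^ lev i) (a t) (y i) then h.choose else Classical.arbitrary T
    have hrep : ∀ i t, IsNear v ((1 / 2) ^ lev i) (a t) (y i) →
        IsNear v ((1 / 2) ^ lev i) (a (rep i)) (y i) := fun i t ht => by
      have h : ∃ t, IsNear v ((1 / 2) ^ lev i) (a t) (y i) := ⟨t, ht⟩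
      simp only [rep, dif_pos h]
      exact h.choose_spec
    have hnear2 : ∀ i t, IsNear v ((1 / 2) ^ lev i) (a t) (y i) →
        IsNear v (2 * (1 / 2) ^ lev i) (a t) (a (rep i)) := fun i t ht => by
      rw [two_mul]; exact ht.trans (hrep i t ht).symm
    have hstd : ∀ s t u, 0 ≤ u → IsNear v u (a s) (a t) →
        Real.sqrt (∑ j, (g j s ^ 2 - g j t ^ 2) ^ 2) ≤ 2 * (α * u) * S := fun s t u hu h =>
      sqrt_sum_sq_sub_sq_le (mul_nonneg hα hu) hS (fun j => hg j s t u hu h) (hgS s) (hgS t)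
    obtain ⟨W, hWint, hW2, hW⟩ := exists_uniform_increment_bound hε hi
      (fun i j => g j (rep i) ^ 2) c hc0 hc1
    set R := Real.sqrt (Fintype.card J) * (4 * α * S) * (1 / 2) ^ K with hR
    have hpt : ∀ᵐ ω ∂P, (⨆ t, ∑ j, ε j ω * g j t ^ 2) ≤
        ∑ j, ε j ω * g j (rep i₀) ^ 2 + 6 * α * S * (360 * A + 4 + 2 * W ω) + R := by
      filter_upwards [ae_all_iff.2 fun j => ae_sign_of_hasLaw (hε j)] with ω hω
      refine ciSup_le fun t => ?_
      obtain ⟨i, hi0, hik, hsum⟩ := hnet (a t) (ha t)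
      set X : T → ℝ := fun t => ∑ j, ε j ω * g j t ^ 2 with hX
      have hXsub : ∀ s t, X s - X t = ∑ j, (g j s ^ 2 - g j t ^ 2) * ε j ω := fun s t => by
        simp only [hX]
        rw [← Finset.sum_sub_distrib]
        exact Finset.sum_congr rfl fun j _ => by ring
      have hlevnear : ∀ k ≤ K, IsNear v (2 * (1 / 2) ^ k) (a t) (a (rep (i k))) := fun k hk => by
        have h := hnear2 (i k) t (by rw [(hik k hk).1]; exact (hik k hk).2)
        rwa [(hik k hk).1] at h
      have htail : X t - X (rep (i K)) ≤ R := by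
        rw [hXsub]
        have h1 := hstd t (rep (i K)) _ (by positivity) (hlevnear K le_rfl)
        have h2 : ∑ j, (g j t ^ 2 - g j (rep (i K)) ^ 2) * ε j ω ≤
            Real.sqrt (Fintype.card J * ∑ j, (g j t ^ 2 - g j (rep (i K)) ^ 2) ^ 2) := by
          refine Real.le_sqrt_of_sq_le ?_
          refine (sq_sum_le_card_mul_sum_sq).trans (le_of_eq ?_)
          rw [Finset.card_univ]
          congr 1
          refine Finset.sum_congr rfl fun j _ => ?_
          rcases hω j with h | h <;> rw [h] <;> ring
        rw [Real.sqrt_mul (Nat.cast_nonneg _)] at h2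
        refine h2.trans ((mul_le_mul_of_nonneg_left h1 (Real.sqrt_nonneg _)).trans (le_of_eq ?_))
        rw [hR]; ring
      -- consecutive links are within `3 * 2⁻ᵏ` of each other
      have hlink : ∀ k ∈ Finset.range K, X (rep (i (k + 1))) - X (rep (i k)) ≤
          6 * α * S * (4 * ((1 / 2) ^ (k + 1) * Real.sqrt (c (i (k + 1)))) +
            2 * ((1 / 2) ^ k * Real.sqrt (c (i k))) + (2 + W ω) * (1 / 2) ^ k) := by
        intro k hk
        have hk' : k < K := Finset.mem_range.1 hk
        rw [hXsub]
        refine ((hW ω).2 (i (k + 1)) (i k)).trans ?_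
        have h1 := hstd (rep (i (k + 1))) (rep (i k)) (3 * (1 / 2) ^ k) (by positivity) (by
          have h := (hlevnear (k + 1) hk').symm.trans (hlevnear k hk'.le)
          convert h using 1
          rw [pow_succ]; ring)
        have h2 : Real.sqrt (c (i (k + 1)) + c (i k) + 1) ≤
            Real.sqrt (c (i (k + 1))) + Real.sqrt (c (i k)) + 1 := by
          rw [Real.sqrt_le_left (by positivity)]
          have e1 := Real.sq_sqrt (hc0 (i (k + 1)))
          have e2 := Real.sq_sqrt (hc0 (i k))
          have e3 := Real.sqrt_nonneg (c (i (k + 1)))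
          have e4 := Real.sqrt_nonneg (c (i k))
          nlinarith [mul_nonneg e3 e4]
        have h3 : 0 ≤ 2 * Real.sqrt (c (i (k + 1)) + c (i k) + 1) + W ω := by
          have := (hW ω).1; positivity
        calc _ ≤ 2 * (α * (3 * (1 / 2) ^ k)) * S *
              (2 * Real.sqrt (c (i (k + 1)) + c (i k) + 1) + W ω) :=
              mul_le_mul_of_nonneg_right h1 h3
          _ ≤ 2 * (α * (3 * (1 / 2) ^ k)) * S *
              (2 * (Real.sqrt (c (i (k + 1))) + Real.sqrt (c (i k)) + 1) + W ω) := by gcongr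
          _ = _ := by rw [pow_succ]; ring
      have htel : X (rep (i K)) - X (rep (i 0)) =
          ∑ k ∈ Finset.range K, (X (rep (i (k + 1))) - X (rep (i k))) :=
        (Finset.sum_range_sub (fun k => X (rep (i k))) K).symm
      have hs1 : ∑ k ∈ Finset.range K, (1 / 2 : ℝ) ^ (k + 1) * Real.sqrt (c (i (k + 1))) ≤
          60 * A := by
        refine le_trans ?_ hsum
        rw [Finset.sum_range_succ']
        exact le_add_of_nonneg_right (by positivity)
      have hs2 : ∑ k ∈ Finset.range K, (1 / 2 : ℝ) ^ k * Real.sqrt (c (i k)) ≤ 60 * A := by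
        refine le_trans ?_ hsum
        rw [Finset.sum_range_succ]
        exact le_add_of_nonneg_right (by positivity)
      have hs3 : ∑ k ∈ Finset.range K, (1 / 2 : ℝ) ^ k ≤ 2 :=
        (sum_geometric_le _ (by norm_num) (by norm_num) _).trans (by norm_num)
      have hchain : X (rep (i K)) - X (rep (i 0)) ≤ 6 * α * S * (360 * A + 4 + 2 * W ω) := by
        rw [htel]
        refine (Finset.sum_le_sum hlink).trans ?_
        rw [← Finset.mul_sum, Finset.sum_add_distrib, Finset.sum_add_distrib, ← Finset.mul_sum,
          ← Finset.mul_sum, ← Finset.mul_sum]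
        have hW0 := (hW ω).1
        have hs3' : (2 + W ω) * ∑ k ∈ Finset.range K, (1 / 2 : ℝ) ^ k ≤ (2 + W ω) * 2 := by gcongr
        refine mul_le_mul_of_nonneg_left ?_ (by positivity)
        linarith
      have hXt : ∑ j, ε j ω * g j t ^ 2 = X t := rfl
      have hX0 : ∑ j, ε j ω * g j (rep i₀) ^ 2 = X (rep (i 0)) := by rw [hi0]
      rw [hXt, hX0]
      linarith
    obtain ⟨hint0, hzero⟩ := integral_rademacher_sum hε fun j => g j (rep i₀) ^ 2
    have hWint' : Integrable (fun ω => 6 * α * S * (360 * A + 4 + 2 * W ω)) P :=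
      ((integrable_const _).add (hWint.const_mul 2)).const_mul _
    have hI : Integrable (fun ω => ∑ j, ε j ω * g j (rep i₀) ^ 2 +
        6 * α * S * (360 * A + 4 + 2 * W ω)) P := hint0.add hWint'
    calc ∫ ω, (⨆ t, ∑ j, ε j ω * g j t ^ 2) ∂P
        ≤ ∫ ω, (∑ j, ε j ω * g j (rep i₀) ^ 2 + 6 * α * S * (360 * A + 4 + 2 * W ω) + R) ∂P :=
          integral_mono_ae (integrable_iSup_rademacher hε (sq_nonneg S) hB)
            (hI.add (integrable_const _)) hpt
      _ = 6 * α * S * (360 * A + 4 + 2 * ∫ ω, W ω ∂P) + R := by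
          rw [integral_add hI (integrable_const _), integral_add hint0 hWint',
            hzero, integral_const_mul, integral_add (integrable_const _) (hWint.const_mul 2),
            integral_const_mul]
          simp
      _ ≤ 6 * α * S * (360 * A + 4 + 2 * 2) + R := by gcongr
      _ ≤ 2300 * A * α * S + R := by
          have : 0 ≤ α * S := by positivity
          nlinarith
  have hlim : Filter.Tendsto (fun K : ℕ => 2300 * A * α * S +
      Real.sqrt (Fintype.card J) * (4 * α * S) * (1 / 2 : ℝ) ^ K) Filter.atTop
      (nhds (2300 * A * α * S + Real.sqrt (Fintype.card J) * (4 * α * S) * 0)) :=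
    (tendsto_const_nhds).add ((tendsto_pow_atTop_nhds_zero_of_lt_one (by norm_num)
      (by norm_num)).const_mul _)
  rw [mul_zero, add_zero] at hlim
  exact ge_of_tendsto' hlim main

/-! ### Compositions of Lipschitz functions with a linear map -/

lemma bddAbove_twoToInftyNorm {n m : ℕ} (A : EuclideanSpace ℝ (Fin n) →ₗ[ℝ] (Fin m → ℝ)) :
    BddAbove (Set.range fun x : Metric.closedBall (0 : EuclideanSpace ℝ (Fin n)) 1 => ‖A x‖) := by
  refine ⟨‖LinearMap.toContinuousLinearMap A‖, ?_⟩
  rintro _ ⟨x, rfl⟩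
  exact (LinearMap.toContinuousLinearMap A).unit_le_opNorm x (mem_closedBall_zero_iff.1 x.2)

lemma norm_apply_le_twoToInftyNorm {n m : ℕ} (A : EuclideanSpace ℝ (Fin n) →ₗ[ℝ] (Fin m → ℝ))
    {x : EuclideanSpace ℝ (Fin n)} (hx : ‖x‖ ≤ 1) : ‖A x‖ ≤ twoToInftyNorm A :=
  le_ciSup (bddAbove_twoToInftyNorm A) ⟨x, by simpa using hx⟩

lemma twoToInftyNorm_nonneg {n m : ℕ} (A : EuclideanSpace ℝ (Fin n) →ₗ[ℝ] (Fin m → ℝ)) :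
    0 ≤ twoToInftyNorm A := Real.iSup_nonneg fun _ => norm_nonneg _

/-- The rows of `A`, divided by `‖A‖_{2 → ∞}`, lie in the Euclidean unit ball. -/
lemma exists_normalized_rows {n m : ℕ} (A : EuclideanSpace ℝ (Fin n) →ₗ[ℝ] (Fin m → ℝ)) :
    ∃ v : Fin m → EuclideanSpace ℝ (Fin n), (∀ p, ‖v p‖ ≤ 1) ∧
      ∀ x p, A x p = twoToInftyNorm A * inner ℝ (v p) x := by
  set N := twoToInftyNorm A with hN
  let row : Fin m → EuclideanSpace ℝ (Fin n) := fun p =>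
    (InnerProductSpace.toDual ℝ _).symm
      (LinearMap.toContinuousLinearMap (LinearMap.proj p ∘ₗ A))
  have hrow : ∀ x p, A x p = inner ℝ (row p) x := fun x p => by
    simp [row]
  have hrowle : ∀ p, ‖row p‖ ≤ N := by
    intro p
    by_cases h0 : row p = 0
    · rw [h0, norm_zero]; exact twoToInftyNorm_nonneg A
    · have hpos : 0 < ‖row p‖ := norm_pos_iff.2 h0
      have h1 := norm_apply_le_twoToInftyNorm A (x := ‖row p‖⁻¹ • row p)
        (by rw [norm_smul, norm_inv, norm_norm, inv_mul_cancel₀ hpos.ne'])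
      have h2 := (norm_le_pi_norm (A (‖row p‖⁻¹ • row p)) p).trans h1
      rw [hrow, inner_smul_right, real_inner_self_eq_norm_sq, Real.norm_eq_abs,
        abs_of_nonneg (by positivity)] at h2
      calc ‖row p‖ = ‖row p‖⁻¹ * ‖row p‖ ^ 2 := by field_simp
        _ ≤ N := h2
  refine ⟨fun p => N⁻¹ • row p, fun p => ?_, fun x p => ?_⟩
  · rw [norm_smul, norm_inv, Real.norm_of_nonneg (twoToInftyNorm_nonneg A)]
    exact inv_mul_le_one_of_le₀ (hrowle p) (twoToInftyNorm_nonneg A)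
  · rw [real_inner_smul_left, hrow]
    rcases (twoToInftyNorm_nonneg A).eq_or_lt with h | h
    · have : row p = 0 := norm_le_zero_iff.1 ((hrowle p).trans h.symm.le)
      rw [this]; simp
    · rw [← mul_assoc, mul_inv_cancel₀ h.ne', one_mul]

lemma bddAbove_maxLipConst {m M : ℕ} {f : Fin M → (Fin m → ℝ) → ℝ}
    (hf : ∀ j, ∃ K : NNReal, LipschitzWith K (f j)) :
    BddAbove (Set.range fun p : Fin M × (Fin m → ℝ) × (Fin m → ℝ) =>
      |f p.1 p.2.1 - f p.1 p.2.2| / ‖p.2.1 - p.2.2‖) := by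
  choose K hK using hf
  refine ⟨∑ j, (K j : ℝ), ?_⟩
  rintro _ ⟨⟨j, z, z'⟩, rfl⟩
  refine le_trans ?_ (Finset.single_le_sum (f := fun j => (K j : ℝ)) (fun j _ => (K j).2)
    (Finset.mem_univ j))
  refine div_le_of_le_mul₀ (norm_nonneg _) (K j).2 ?_
  have := (hK j).dist_le_mul z z'
  rwa [Real.dist_eq, dist_eq_norm] at this

lemma abs_sub_le_maxLipConst_mul {m M : ℕ} {f : Fin M → (Fin m → ℝ) → ℝ}
    (hf : ∀ j, ∃ K : NNReal, LipschitzWith K (f j)) (j : Fin M) (z z' : Fin m → ℝ) :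
    |f j z - f j z'| ≤ maxLipConst f * ‖z - z'‖ := by
  rcases eq_or_ne z z' with rfl | h
  · simp
  · have hpos : 0 < ‖z - z'‖ := norm_pos_iff.2 (sub_ne_zero.2 h)
    exact (div_le_iff₀ hpos).1 (le_ciSup (bddAbove_maxLipConst hf) (j, z, z'))

lemma maxLipConst_nonneg {m M : ℕ} (f : Fin M → (Fin m → ℝ) → ℝ) : 0 ≤ maxLipConst f :=
  Real.iSup_nonneg fun _ => div_nonneg (abs_nonneg _) (norm_nonneg _)

/-- A uniform bound on `f j (A x)` over the unit ball. -/
lemma exists_abs_apply_le {n m M : ℕ} (A : EuclideanSpace ℝ (Fin n) →ₗ[ℝ] (Fin m → ℝ))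
    {f : Fin M → (Fin m → ℝ) → ℝ} (hf : ∀ j, ∃ K : NNReal, LipschitzWith K (f j)) :
    ∃ B, 0 ≤ B ∧ ∀ j (x : EuclideanSpace ℝ (Fin n)), ‖x‖ ≤ 1 → |f j (A x)| ≤ B := by
  have h0 : 0 ≤ maxLipConst f * twoToInftyNorm A :=
    mul_nonneg (maxLipConst_nonneg f) (twoToInftyNorm_nonneg A)
  refine ⟨∑ j, |f j 0| + maxLipConst f * twoToInftyNorm A,
    add_nonneg (Finset.sum_nonneg fun j _ => abs_nonneg _) h0, fun j x hx => ?_⟩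
  have h1 := abs_sub_le_maxLipConst_mul hf j (A x) 0
  rw [sub_zero] at h1
  have h2 : |f j (A x)| ≤ |f j 0| + |f j (A x) - f j 0| := by
    have := abs_add_le (f j 0) (f j (A x) - f j 0)
    rwa [add_sub_cancel] at this
  have h3 : |f j 0| ≤ ∑ j, |f j 0| :=
    Finset.single_le_sum (f := fun j => |f j 0|) (fun j _ => abs_nonneg _) (Finset.mem_univ j)
  have h4 := mul_le_mul_of_nonneg_left (norm_apply_le_twoToInftyNorm A hx) (maxLipConst_nonneg f)
  linarith

/-- The Rademacher process `x ↦ ∑ ε_j f_j(A x) ^ 2` over a subset of the unit ball. -/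
theorem rademacher_lipschitz_sq_bound {n m M : ℕ} (hn : 2 ≤ n) (hm : 2 ≤ m)
    (A : EuclideanSpace ℝ (Fin n) →ₗ[ℝ] (Fin m → ℝ)) {f : Fin M → (Fin m → ℝ) → ℝ}
    (hf : ∀ j, ∃ K : NNReal, LipschitzWith K (f j))
    {T : Set (EuclideanSpace ℝ (Fin n))} (hT : T ⊆ Metric.closedBall 0 1)
    {Ω : Type*} [MeasurableSpace Ω] {P : Measure Ω} [IsProbabilityMeasure P]
    {ε : Fin M → Ω → ℝ} (hε : ∀ j, HasLaw (ε j) signLaw P) (hi : iIndepFun ε P) :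
    BddAbove (Set.range fun x : T => ∑ j, f j (A x) ^ 2) ∧
      Integrable (fun ω => ⨆ x : T, ∑ j, ε j ω * f j (A x) ^ 2) P ∧
      ∫ ω, (⨆ x : T, ∑ j, ε j ω * f j (A x) ^ 2) ∂P ≤
        2300 * Real.sqrt (Real.log m * Real.log n) * twoToInftyNorm A * maxLipConst f *
          ⨆ x : T, Real.sqrt (∑ j, f j (A x) ^ 2) := by
  obtain ⟨B, hB0, hB⟩ := exists_abs_apply_le A hf
  have hball : ∀ x : T, ‖(x : EuclideanSpace ℝ (Fin n))‖ ≤ 1 := fun x => by simpa using hT x.2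
  have hB2 : ∀ (x : T) j, f j (A x) ^ 2 ≤ B ^ 2 := fun x j =>
    sq_le_sq' (abs_le.1 (hB j x (hball x))).1 (abs_le.1 (hB j x (hball x))).2
  have hbdd : BddAbove (Set.range fun x : T => ∑ j, f j (A x) ^ 2) := by
    refine ⟨∑ _j : Fin M, B ^ 2, ?_⟩
    rintro _ ⟨x, rfl⟩
    exact Finset.sum_le_sum fun j _ => hB2 x j
  refine ⟨hbdd, ?_, ?_⟩
  · exact integrable_iSup_rademacher (h := fun (x : T) j => f j (A x) ^ 2) hε (sq_nonneg B)
      fun x j => by rw [abs_of_nonneg (sq_nonneg _)]; exact hB2 x j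
  rcases isEmpty_or_nonempty T with hTe | hTn
  · simp
  obtain ⟨v, hv, hAv⟩ := exists_normalized_rows A
  set S := ⨆ x : T, Real.sqrt (∑ j, f j (A x) ^ 2) with hS
  have hbdd' : BddAbove (Set.range fun x : T => Real.sqrt (∑ j, f j (A x) ^ 2)) := by
    obtain ⟨b, hb⟩ := hbdd
    refine ⟨Real.sqrt b, ?_⟩
    rintro _ ⟨x, rfl⟩
    exact Real.sqrt_le_sqrt (hb ⟨x, rfl⟩)
  have key := integral_iSup_rademacher_sq_le (ι := Fin n) (κ := Fin m)
    (by simpa using hn) (by simpa using hm) hv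
    (a := fun x : T => (x : EuclideanSpace ℝ (Fin n))) hball
    (g := fun j x => f j (A x)) (α := maxLipConst f * twoToInftyNorm A) (S := S)
    (mul_nonneg (maxLipConst_nonneg f) (twoToInftyNorm_nonneg A))
    (Real.iSup_nonneg fun _ => Real.sqrt_nonneg _)
    (fun j s t u hu hst => by
      refine (abs_sub_le_maxLipConst_mul hf j _ _).trans ?_
      rw [mul_assoc]
      refine mul_le_mul_of_nonneg_left ?_ (maxLipConst_nonneg f)
      rw [← map_sub, pi_norm_le_iff_of_nonneg (mul_nonneg (twoToInftyNorm_nonneg A) hu)]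
      intro p
      rw [hAv, Real.norm_eq_abs, abs_mul, abs_of_nonneg (twoToInftyNorm_nonneg A)]
      exact mul_le_mul_of_nonneg_left (hst p) (twoToInftyNorm_nonneg A))
    (fun x => (Real.sqrt_le_left (Real.iSup_nonneg fun _ => Real.sqrt_nonneg _)).1
      (le_ciSup hbdd' x)) hε hi
  refine key.trans (le_of_eq ?_)
  simp only [Fintype.card_fin]
  ring

/-! ### Balanced quadratic forms -/

section Balanced

open Matrix

/-- The maximum of the squares of finitely many linear forms `x ↦ b p ⬝ᵥ x`. -/
noncomputable def maxSq {V κ : Type*} [Fintype V] [Fintype κ] (b : κ → V → ℝ) (x : V → ℝ) : ℝ := ‖fun p => b p ⬝ᵥ x‖ ^ 2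

lemma maxSq_nonneg {V κ : Type*} [Fintype V] [Fintype κ] (b : κ → V → ℝ) (x : V → ℝ) : 0 ≤ maxSq b x := sq_nonneg _

lemma sq_dotProduct_le_maxSq {V κ : Type*} [Fintype V] [Fintype κ] (b : κ → V → ℝ) (x : V → ℝ) (p : κ) : (b p ⬝ᵥ x) ^ 2 ≤ maxSq b x := by
  have h := norm_le_pi_norm (fun p => b p ⬝ᵥ x) p
  rw [Real.norm_eq_abs] at h
  rw [maxSq, ← sq_abs]
  exact pow_le_pow_left₀ (abs_nonneg _) h 2

variable {V κ ι : Type*} [Fintype κ] [Fintype ι] [DecidableEq V]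

/-- The regularized quadratic form `δ |x|² + ∑_i w_i ∑_p c_{i,p} (b_{i,p} ⬝ᵥ x)²`. -/
noncomputable def weightedGram (δ : ℝ) (w : ι → ℝ) (b : ι → κ → V → ℝ) (c : ι → κ → ℝ) :
    Matrix V V ℝ :=
  δ • 1 + ∑ i, w i • ∑ p, c i p • vecMulVec (b i p) (b i p)

lemma continuous_weightedGram (δ : ℝ) (w : ι → ℝ) (b : ι → κ → V → ℝ) :
    Continuous (weightedGram δ w b) := by
  unfold weightedGram; fun_prop

lemma isHermitian_weightedGram (δ : ℝ) (w : ι → ℝ) (b : ι → κ → V → ℝ) (c : ι → κ → ℝ) :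
    (weightedGram δ w b c).IsHermitian := by
  ext u u'
  simp only [weightedGram, conjTranspose_apply, star_trivial, Matrix.add_apply, Matrix.smul_apply, Matrix.sum_apply,
    vecMulVec_apply, smul_eq_mul, one_apply, eq_comm (a := u), mul_comm (b _ _ u)]

lemma weightedGram_lineMap (δ : ℝ) (w : ι → ℝ) (b : ι → κ → V → ℝ) (c c' : ι → κ → ℝ) (t : ℝ) :
    weightedGram δ w b (fun i p => c i p + t * (c' i p - c i p)) = weightedGram δ w b c +
      t • (weightedGram δ w b c' - weightedGram δ w b c) := by
  ext u u'
  simp only [weightedGram, Matrix.add_apply, Matrix.smul_apply, Matrix.sub_apply, Matrix.sum_apply, vecMulVec_apply,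
    smul_eq_mul, add_mul, sub_mul, Finset.sum_add_distrib, Finset.sum_sub_distrib, mul_add, mul_sub,
    mul_assoc, Finset.mul_sum]
  simp only [mul_left_comm (w _) t]
  ring

variable [Fintype V]

lemma dotProduct_weightedGram (δ : ℝ) (w : ι → ℝ) (b : ι → κ → V → ℝ) (c : ι → κ → ℝ)
    (x : V → ℝ) : x ⬝ᵥ weightedGram δ w b c *ᵥ x =
      δ * (x ⬝ᵥ x) + ∑ i, w i * ∑ p, c i p * (b i p ⬝ᵥ x) ^ 2 := by
  simp only [weightedGram, add_mulVec, smul_mulVec, sum_mulVec, one_mulVec, vecMulVec_mulVec,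
    dotProduct_add, dotProduct_smul, dotProduct_sum, smul_eq_mul, op_smul_eq_smul]
  congr 1
  refine Finset.sum_congr rfl fun i _ => ?_
  congr 1
  refine Finset.sum_congr rfl fun p _ => ?_
  rw [dotProduct_comm x (b i p)]; ring

lemma trace_mul_weightedGram (N : Matrix V V ℝ) (δ : ℝ) (w : ι → ℝ) (b : ι → κ → V → ℝ)
    (c : ι → κ → ℝ) : trace (N * weightedGram δ w b c) =
      δ * trace N + ∑ i, w i * ∑ p, c i p * (b i p ⬝ᵥ N *ᵥ b i p) := by
  simp only [weightedGram, mul_add, Finset.mul_sum, mul_smul_comm, mul_one, mul_vecMulVec,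
    trace_add, trace_smul, trace_sum, trace_vecMulVec, smul_eq_mul]
  simp only [dotProduct_comm (N *ᵥ _)]

lemma posDef_weightedGram {δ : ℝ} (hδ : 0 < δ) {w : ι → ℝ} (hw : ∀ i, 0 ≤ w i)
    (b : ι → κ → V → ℝ) {c : ι → κ → ℝ} (hc : ∀ i p, 0 ≤ c i p) :
    (weightedGram δ w b c).PosDef := by
  refine PosDef.of_dotProduct_mulVec_pos (isHermitian_weightedGram δ w b c) fun x hx => ?_
  rw [star_trivial, dotProduct_weightedGram]
  have h1 : 0 < x ⬝ᵥ x := by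
    have := dotProduct_star_self_pos_iff.2 hx
    rwa [star_trivial] at this
  have h2 : 0 ≤ ∑ i, w i * ∑ p, c i p * (b i p ⬝ᵥ x) ^ 2 :=
    Finset.sum_nonneg fun i _ => mul_nonneg (hw i)
      (Finset.sum_nonneg fun p _ => mul_nonneg (hc i p) (sq_nonneg _))
  positivity

/-- If `1` is the maximum of `t ↦ det (1 + t M)` on `[0, 1]`, then the derivative of this function
at `0`, which is the trace of `M`, is not positive. -/
lemma trace_nonpos_of_det_one_add_smul_le {M : Matrix V V ℝ}
    (h : ∀ t : ℝ, 0 < t → t ≤ 1 → det (1 + t • M) ≤ 1) : trace M ≤ 0 := by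
  set q := (det (1 + (Polynomial.X : Polynomial ℝ) • M.map Polynomial.C)).divX.divX
  have hlim : Filter.Tendsto (fun t : ℝ => trace M + q.eval t * t) (nhdsWithin 0 (Set.Ioi 0))
      (nhds (trace M + q.eval 0 * 0)) :=
    ((continuous_const.add (q.continuous.mul continuous_id)).tendsto 0).mono_left
      nhdsWithin_le_nhds
  rw [mul_zero, add_zero] at hlim
  refine le_of_tendsto hlim ?_
  filter_upwards [Ioc_mem_nhdsGT (show (0 : ℝ) < 1 by norm_num)] with t ht
  have h1 := h t ht.1 ht.2
  rw [det_one_add_smul] at h1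
  have h2 : t * (trace M + q.eval t * t) ≤ t * 0 := by
    have : q.eval t * t ^ 2 = t * (q.eval t * t) := by ring
    linarith
  exact le_of_mul_le_mul_left h2 ht.1

/-- Maximizing the determinant over all ways to distribute the weights `w i` among the forms
`b i p` yields a quadratic form below `δ |x|² + ∑ w_i max_p (b_{i,p} ⬝ᵥ x)²` with respect to which
the total weighted leverage `∑ w_i max_p b_{i,p} ⬝ᵥ L⁻¹ b_{i,p}` is at most the dimension. This is
the Kiefer–Wolfowitz argument for groups of vectors. -/
theorem exists_posDef_balanced [Nonempty κ] {δ : ℝ} (hδ : 0 < δ) {w : ι → ℝ} (hw : ∀ i, 0 ≤ w i)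
    (b : ι → κ → V → ℝ) :
    ∃ (L : Matrix V V ℝ) (R : ι → ℝ), L.PosDef ∧
      (∀ x, x ⬝ᵥ L *ᵥ x ≤ δ * (x ⬝ᵥ x) + ∑ i, w i * maxSq (b i) x) ∧
      (∀ i p, b i p ⬝ᵥ L⁻¹ *ᵥ b i p ≤ R i) ∧ (∀ i, 0 ≤ R i) ∧
      ∑ i, w i * R i ≤ Fintype.card V := by
  classical
  let Δ : Set (ι → κ → ℝ) := Set.univ.pi fun _ => stdSimplex ℝ κ
  have hΔ : IsCompact Δ := isCompact_univ_pi fun _ => isCompact_stdSimplex ℝ κ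
  have hne : Δ.Nonempty := ⟨fun _ => Pi.single (Classical.arbitrary κ) 1,
    fun i _ => single_mem_stdSimplex ℝ _⟩
  obtain ⟨c, hcΔ, hmax⟩ := hΔ.exists_isMaxOn hne
    ((continuous_weightedGram δ w b).matrix_det.continuousOn)
  have hc0 : ∀ i p, 0 ≤ c i p := fun i p => (hcΔ i trivial).1 p
  have hc1 : ∀ i, ∑ p, c i p = 1 := fun i => (hcΔ i trivial).2
  set L := weightedGram δ w b c with hL
  have hLpos : L.PosDef := posDef_weightedGram hδ hw b hc0
  have hLdet : 0 < L.det := hLpos.det_pos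
  have hLinv : L⁻¹ * L = 1 := nonsing_inv_mul _ (isUnit_iff_ne_zero.2 hLdet.ne')
  have hLinv' : L * L⁻¹ = 1 := mul_nonsing_inv _ (isUnit_iff_ne_zero.2 hLdet.ne')
  have harg : ∀ i, ∃ p, ∀ p', b i p' ⬝ᵥ L⁻¹ *ᵥ b i p' ≤ b i p ⬝ᵥ L⁻¹ *ᵥ b i p := fun i =>
    Finite.exists_max fun p => b i p ⬝ᵥ L⁻¹ *ᵥ b i p
  choose p₀ hp₀ using harg
  refine ⟨L, fun i => b i (p₀ i) ⬝ᵥ L⁻¹ *ᵥ b i (p₀ i), hLpos, fun x => ?_, fun i p => hp₀ i p,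
    fun i => ?_, ?_⟩
  · rw [hL, dotProduct_weightedGram]
    gcongr with i
    · exact hw i
    · calc ∑ p, c i p * (b i p ⬝ᵥ x) ^ 2 ≤ ∑ p, c i p * maxSq (b i) x :=
            Finset.sum_le_sum fun p _ =>
              mul_le_mul_of_nonneg_left (sq_dotProduct_le_maxSq _ _ _) (hc0 i p)
        _ = maxSq (b i) x := by rw [← Finset.sum_mul, hc1, one_mul]
  · have := hLpos.inv.posSemidef.dotProduct_mulVec_nonneg (b i (p₀ i))
    rwa [star_trivial] at this
  · -- the competitor puts the whole weight of `i` on the form of largest leverage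
    set c' : ι → κ → ℝ := fun i => Pi.single (p₀ i) 1 with hc'
    have hc'mem : ∀ i, c' i ∈ stdSimplex ℝ κ := fun i => single_mem_stdSimplex ℝ _
    set L' := weightedGram δ w b c' with hL'
    have htr : trace (L⁻¹ * (L' - L)) ≤ 0 := by
      refine trace_nonpos_of_det_one_add_smul_le fun t ht0 ht1 => ?_
      have hmem : (fun i p => c i p + t * (c' i p - c i p)) ∈ Δ := fun i _ => by
        have := (convex_stdSimplex ℝ κ).add_smul_sub_mem (hcΔ i trivial) (hc'mem i) ⟨ht0.le, ht1⟩
        exact this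
      have h1 : det (weightedGram δ w b fun i p => c i p + t * (c' i p - c i p)) ≤ det L :=
        hmax hmem
      rw [weightedGram_lineMap, ← hL, ← hL'] at h1
      have h2 : L + t • (L' - L) = L * (1 + t • (L⁻¹ * (L' - L))) := by
        rw [mul_add, mul_one, mul_smul_comm, ← mul_assoc, hLinv', one_mul]
      rw [h2, det_mul] at h1
      exact le_of_mul_le_mul_left (by linarith) hLdet
    rw [mul_sub, trace_sub, hLinv, trace_one, hL', trace_mul_weightedGram] at htr
    have h3 : ∀ i, ∑ p, c' i p * (b i p ⬝ᵥ L⁻¹ *ᵥ b i p) =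
        b i (p₀ i) ⬝ᵥ L⁻¹ *ᵥ b i (p₀ i) := fun i => by
      rw [Finset.sum_eq_single (p₀ i)]
      · simp [hc']
      · intro p _ hp; simp [hc', hp]
      · simp
    simp only [h3] at htr
    have h4 : 0 ≤ trace L⁻¹ := hLpos.inv.posSemidef.trace_nonneg
    nlinarith

open scoped MatrixOrder in
/-- A positive definite form `L` as the square of a Euclidean norm: `a` is the change of
coordinates, and `u d` represents the linear form `d`. -/
lemma exists_whitening {L : Matrix V V ℝ} (hL : L.PosDef) :
    ∃ a u : (V → ℝ) → EuclideanSpace ℝ V, (∀ x, ‖a x‖ ^ 2 = x ⬝ᵥ L *ᵥ x) ∧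
      (∀ d x, inner ℝ (u d) (a x) = d ⬝ᵥ x) ∧ ∀ d, ‖u d‖ ^ 2 = d ⬝ᵥ L⁻¹ *ᵥ d := by
  obtain ⟨B, hB⟩ := CStarAlgebra.nonneg_iff_eq_star_mul_self.mp hL.posSemidef.nonneg
  have hB' : L = Bᵀ * B := by rw [hB, star_eq_conjTranspose, conjTranspose_eq_transpose_of_trivial]
  have hLinv : L * L⁻¹ = 1 := mul_nonsing_inv _ (isUnit_iff_ne_zero.2 hL.det_pos.ne')
  have hin : ∀ x y : V → ℝ, inner ℝ (WithLp.toLp 2 (B *ᵥ x)) (WithLp.toLp 2 (B *ᵥ y)) =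
      (L *ᵥ x) ⬝ᵥ y := by
    intro x y
    rw [EuclideanSpace.inner_toLp_toLp, star_trivial, dotProduct_comm, dotProduct_mulVec,
      ← mulVec_transpose, mulVec_mulVec, ← hB']
  refine ⟨fun x => WithLp.toLp 2 (B *ᵥ x), fun d => WithLp.toLp 2 (B *ᵥ (L⁻¹ *ᵥ d)),
    fun x => ?_, fun d x => ?_, fun d => ?_⟩
  · rw [← real_inner_self_eq_norm_sq, hin, dotProduct_comm]
  · rw [hin, mulVec_mulVec, hLinv, one_mulVec]
  · rw [← real_inner_self_eq_norm_sq, hin, mulVec_mulVec, hLinv, one_mulVec]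

end Balanced

/-! ### Halving -/

lemma hasLaw_neg_signLaw : HasLaw (fun x : ℝ => -x) signLaw signLaw where
  aemeasurable := measurable_neg.aemeasurable
  map_eq := by
    rw [signLaw, Measure.map_add _ _ measurable_neg, Measure.map_smul, Measure.map_smul,
      Measure.map_dirac, Measure.map_dirac, neg_neg, add_comm]

/-- Signs for which a Rademacher process over the index set `T` is at most `2 * K` in absolute
value, where `K` bounds the expected supremum. The process must vanish somewhere, so that its
supremum and that of its negative are not negative. -/
lemma exists_signs_abs_sum_le {J T : Type*} [Fintype J] [Nonempty T] {h : T → J → ℝ} {B K : ℝ}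
    (hB0 : 0 ≤ B) (hB : ∀ t j, |h t j| ≤ B) {t₀ : T} (ht₀ : ∀ j, h t₀ j = 0)
    (hK : ∀ ε : J → (J → ℝ) → ℝ, (∀ j, HasLaw (ε j) signLaw (Measure.pi fun _ => signLaw)) →
      iIndepFun ε (Measure.pi fun _ => signLaw) →
      ∫ ω, (⨆ t, ∑ j, ε j ω * h t j) ∂(Measure.pi fun _ : J => signLaw) ≤ K) :
    ∃ σ : J → ℝ, (∀ j, σ j = 1 ∨ σ j = -1) ∧ ∀ t, |∑ j, σ j * h t j| ≤ 2 * K := by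
  have hlaw : ∀ j : J, HasLaw (fun ω : J → ℝ => ω j) signLaw (Measure.pi fun _ => signLaw) :=
    fun j => (measurePreserving_eval (fun _ : J => signLaw) j).hasLaw
  have hind : iIndepFun (fun (j : J) (ω : J → ℝ) => ω j) (Measure.pi fun _ => signLaw) :=
    iIndepFun_pi (X := fun _ => id) fun _ => aemeasurable_id
  have hlaw' : ∀ j : J, HasLaw (fun ω : J → ℝ => -ω j) signLaw (Measure.pi fun _ => signLaw) :=
    fun j => hasLaw_neg_signLaw.comp (hlaw j)
  have hind' : iIndepFun (fun (j : J) (ω : J → ℝ) => -ω j) (Measure.pi fun _ => signLaw) :=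
    hind.comp (fun _ x => -x) fun _ => measurable_neg
  have hint := integrable_iSup_rademacher hlaw hB0 hB
  have hint' := integrable_iSup_rademacher hlaw' hB0 hB
  have hnull : (Measure.pi fun _ : J => signLaw) {ω | ¬ ∀ j, ω j = 1 ∨ ω j = -1} = 0 :=
    ae_iff.1 (ae_all_iff.2 fun j => ae_sign_of_hasLaw (hlaw j))
  obtain ⟨σ, hσ, hle⟩ := exists_notMem_null_le_integral (hint.add hint') hnull
  rw [Set.mem_ofPred_eq, not_not] at hσ
  refine ⟨σ, hσ, fun t => ?_⟩
  rw [integral_add' hint hint'] at hle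
  have h1 := hK _ hlaw hind
  have h2 := hK _ hlaw' hind'
  simp only [Pi.add_apply] at hle
  have hb := bddAbove_range_sum_mul hB σ
  have hb' := bddAbove_range_sum_mul hB fun j => -σ j
  have e1 := le_ciSup hb t
  have e2 := le_ciSup hb' t
  have e3 := le_ciSup hb t₀
  have e4 := le_ciSup hb' t₀
  simp only [ht₀, mul_zero, Finset.sum_const_zero, neg_mul, Finset.sum_neg_distrib] at e1 e2 e3 e4 hle h2
  rw [abs_le]
  constructor <;> linarith

open Matrix in
/-- One halving step. If every weighted leverage `ω_j b_{j,p} ⬝ᵥ L⁻¹ b_{j,p}` is at most `ρ`, then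
at most half of the terms, with doubled weights, approximate the sum up to
`√(log m * log n) * √ρ`, where `m` bounds the number of different forms. -/
theorem exists_half_sum_maxSq {V κ J : Type*} [Fintype V] [DecidableEq V] [Fintype κ] [Fintype J]
    (hn : 2 ≤ Fintype.card V) (hm : 2 ≤ Fintype.card κ) {L : Matrix V V ℝ} (hL : L.PosDef)
    {d : κ → V → ℝ} {b : J → κ → V → ℝ} (hb : ∀ j p, b j p = 0 ∨ b j p = d p)
    {ω : J → ℝ} (hω : ∀ j, 0 ≤ ω j) {ρ : ℝ}
    (hρ : ∀ j p, ω j * (b j p ⬝ᵥ L⁻¹ *ᵥ b j p) ≤ ρ) {T : Set (V → ℝ)} (h0 : 0 ∈ T)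
    (hT : ∀ x ∈ T, x ⬝ᵥ L *ᵥ x ≤ 2) (hT2 : ∀ x ∈ T, ∑ j, ω j * maxSq (b j) x ≤ 2) :
    ∃ s : Finset J, 2 * s.card ≤ Fintype.card J ∧ ∀ x ∈ T,
      |∑ j ∈ s, 2 * (ω j * maxSq (b j) x) - ∑ j, ω j * maxSq (b j) x| ≤
        9200 * Real.sqrt (Real.log (Fintype.card κ) * Real.log (Fintype.card V)) * Real.sqrt ρ := by
  classical
  obtain ⟨a, u, ha, hua, hu⟩ := exists_whitening hL
  set r2 := Real.sqrt 2 with hr2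
  have hr2pos : 0 < r2 := Real.sqrt_pos.2 (by norm_num)
  have hr2sq : r2 ^ 2 = 2 := Real.sq_sqrt (by norm_num)
  let v : κ → EuclideanSpace ℝ V := fun p => ‖u (d p)‖⁻¹ • u (d p)
  have hv : ∀ p, ‖v p‖ ≤ 1 := fun p => by
    simp only [v]
    rw [norm_smul, norm_inv, norm_norm]
    exact inv_mul_le_one_of_le₀ le_rfl (norm_nonneg _)
  have huv : ∀ p, u (d p) = ‖u (d p)‖ • v p := fun p => by
    simp only [v]
    rcases eq_or_ne (u (d p)) 0 with h | h
    · simp [h]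
    · rw [smul_smul, mul_inv_cancel₀ (norm_ne_zero_iff.2 h), one_smul]
  let g : J → T → ℝ := fun j x => Real.sqrt (ω j) * ‖fun p => b j p ⬝ᵥ (x : V → ℝ)‖
  have hg2 : ∀ j (x : T), g j x ^ 2 = ω j * maxSq (b j) x := fun j x => by
    simp only [g]
    rw [mul_pow, Real.sq_sqrt (hω j), maxSq]
  have : Nonempty T := ⟨⟨0, h0⟩⟩
  have hbound : ∀ x : T, ∑ j, g j x ^ 2 ≤ r2 ^ 2 := fun x => by
    simp only [hg2]; rw [hr2sq]; exact hT2 x x.2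
  have hlip : ∀ j (s t : T) (c : ℝ), 0 ≤ c → IsNear v c (r2⁻¹ • a s) (r2⁻¹ • a t) →
      |g j s - g j t| ≤ r2 * Real.sqrt ρ * c := by
    intro j s t c hc hst
    have hC : 0 ≤ r2 * Real.sqrt ρ * c := by positivity
    calc |g j s - g j t| = Real.sqrt (ω j) *
          |‖fun p => b j p ⬝ᵥ (s : V → ℝ)‖ - ‖fun p => b j p ⬝ᵥ (t : V → ℝ)‖| := by
          simp only [g]
          rw [← mul_sub, abs_mul, abs_of_nonneg (Real.sqrt_nonneg _)]
      _ ≤ Real.sqrt (ω j) *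
          ‖(fun p => b j p ⬝ᵥ (s : V → ℝ)) - fun p => b j p ⬝ᵥ (t : V → ℝ)‖ :=
          mul_le_mul_of_nonneg_left (abs_norm_sub_norm_le _ _) (Real.sqrt_nonneg _)
      _ = ‖Real.sqrt (ω j) •
          ((fun p => b j p ⬝ᵥ (s : V → ℝ)) - fun p => b j p ⬝ᵥ (t : V → ℝ))‖ := by
          rw [norm_smul, Real.norm_of_nonneg (Real.sqrt_nonneg _)]
      _ ≤ r2 * Real.sqrt ρ * c := by
          rw [pi_norm_le_iff_of_nonneg hC]
          intro p
          rw [Pi.smul_apply, Pi.sub_apply, smul_eq_mul, Real.norm_eq_abs, abs_mul,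
            abs_of_nonneg (Real.sqrt_nonneg _)]
          rcases hb j p with hp | hp
          · simpa [hp] using hC
          · have h1 : b j p ⬝ᵥ (s : V → ℝ) - b j p ⬝ᵥ (t : V → ℝ) =
                r2 * (‖u (d p)‖ * inner ℝ (v p) (r2⁻¹ • a s - r2⁻¹ • a t)) := by
              rw [hp, ← hua, ← hua, ← inner_sub_right, ← smul_sub, inner_smul_right]
              conv_lhs => rw [huv, real_inner_smul_left]
              field_simp
            have h2 : Real.sqrt (ω j) * ‖u (d p)‖ ≤ Real.sqrt ρ := by
              refine Real.le_sqrt_of_sq_le ?_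
              rw [mul_pow, Real.sq_sqrt (hω j), hu, ← hp]
              exact hρ j p
            rw [h1, abs_mul, abs_mul, abs_of_pos hr2pos, abs_of_nonneg (norm_nonneg _)]
            calc _ = r2 * (Real.sqrt (ω j) * ‖u (d p)‖) *
                  |inner ℝ (v p) (r2⁻¹ • a s - r2⁻¹ • a t)| := by ring
              _ ≤ r2 * Real.sqrt ρ * c := by gcongr; exact hst p
  have hball : ∀ t : T, ‖r2⁻¹ • a t‖ ≤ 1 := fun t => by
    have h1 : ‖a t‖ ≤ r2 := Real.le_sqrt_of_sq_le (by rw [ha]; exact hT t t.2)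
    rw [norm_smul, norm_inv, Real.norm_of_nonneg hr2pos.le]
    exact inv_mul_le_one_of_le₀ h1 hr2pos.le
  have hmaxsq0 : ∀ j, maxSq (b j) 0 = 0 := fun j => by
    have : (fun p => b j p ⬝ᵥ (0 : V → ℝ)) = 0 := by ext p; simp
    rw [maxSq, this]; simp
  obtain ⟨σ, hσ, hσT⟩ := exists_signs_abs_sum_le (T := T) (h := fun x j => g j x ^ 2)
    (sq_nonneg r2) (fun t j => by
      rw [abs_of_nonneg (sq_nonneg _)]
      exact (Finset.single_le_sum (f := fun j => g j t ^ 2) (fun j _ => sq_nonneg _)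
        (Finset.mem_univ j)).trans (hbound t))
    (t₀ := ⟨0, h0⟩) (fun j => by rw [hg2, hmaxsq0, mul_zero])
    (fun ε hε hi => integral_iSup_rademacher_sq_le hn hm hv hball
      (by positivity) hr2pos.le hlip hbound hε hi)
  simp only [hg2] at hσT
  have hbd : ∀ x ∈ T, |∑ j, σ j * (ω j * maxSq (b j) x)| ≤
      9200 * Real.sqrt (Real.log (Fintype.card κ) * Real.log (Fintype.card V)) * Real.sqrt ρ := by
    intro x hx
    refine (hσT ⟨x, hx⟩).trans (le_of_eq ?_)
    linear_combination 4600 * Real.sqrt (Real.log (Fintype.card κ) * Real.log (Fintype.card V)) *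
      Real.sqrt ρ * hr2sq
  have hcard : (Finset.univ.filter fun j => σ j = 1).card +
      (Finset.univ.filter fun j => ¬ σ j = 1).card = Fintype.card J := by
    rw [Finset.card_filter_add_card_filter_not, Finset.card_univ]
  -- keep the smaller one of the two sign classes
  rcases le_total (Finset.univ.filter fun j => σ j = 1).card
    (Finset.univ.filter fun j => ¬ σ j = 1).card with hc | hc
  · refine ⟨Finset.univ.filter fun j => σ j = 1, by omega, fun x hx => ?_⟩
    convert hbd x hx using 2
    rw [Finset.sum_filter, ← Finset.sum_sub_distrib]
    refine Finset.sum_congr rfl fun j _ => ?_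
    rcases hσ j with h | h
    · rw [if_pos h, h]; ring
    · rw [if_neg (by rw [h]; norm_num), h]; ring
  · refine ⟨Finset.univ.filter fun j => ¬ σ j = 1, by omega, fun x hx => ?_⟩
    rw [← abs_neg]
    convert hbd x hx using 2
    rw [Finset.sum_filter, ← Finset.sum_sub_distrib, ← Finset.sum_neg_distrib]
    refine Finset.sum_congr rfl fun j _ => ?_
    rcases hσ j with h | h
    · rw [if_neg (not_not.2 h), h]; ring
    · rw [if_pos (by rw [h]; norm_num), h]; ring

/-! ### Sparsification of sums of maxima of squares -/

open Matrix in
/-- Iterated halving. The errors of the successive steps grow geometrically, so that the total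
error is governed by the last one; `23000 * (√2 - 1) ≥ 9200`. -/
lemma exists_iterated_half_sum_maxSq {V κ J : Type*} [Fintype V] [DecidableEq V] [Fintype κ]
    [Fintype J] (hn : 2 ≤ Fintype.card V) (hm : 2 ≤ Fintype.card κ) {L : Matrix V V ℝ}
    (hL : L.PosDef) {d : κ → V → ℝ} {b : J → κ → V → ℝ} (hb : ∀ j p, b j p = 0 ∨ b j p = d p)
    {ω : J → ℝ} (hω : ∀ j, 0 ≤ ω j) {ρ : ℝ} (hρ0 : 0 ≤ ρ)
    (hρ : ∀ j p, ω j * (b j p ⬝ᵥ L⁻¹ *ᵥ b j p) ≤ ρ) {T : Set (V → ℝ)} (h0 : 0 ∈ T)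
    (hT : ∀ x ∈ T, x ⬝ᵥ L *ᵥ x ≤ 2) (hT1 : ∀ x ∈ T, ∑ j, ω j * maxSq (b j) x ≤ 1) (t : ℕ)
    (ht : 23000 * Real.sqrt (Real.log (Fintype.card κ) * Real.log (Fintype.card V)) *
      Real.sqrt (2 ^ t * ρ) ≤ 1) :
    ∃ s : Finset J, 2 ^ t * s.card ≤ Fintype.card J ∧ ∀ x ∈ T,
      |∑ j ∈ s, 2 ^ t * (ω j * maxSq (b j) x) - ∑ j, ω j * maxSq (b j) x| ≤
        23000 * Real.sqrt (Real.log (Fintype.card κ) * Real.log (Fintype.card V)) *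
          Real.sqrt (2 ^ t * ρ) := by
  classical
  set A := Real.sqrt (Real.log (Fintype.card κ) * Real.log (Fintype.card V)) with hA
  induction t with
  | zero =>
    refine ⟨Finset.univ, by simp, fun x _ => ?_⟩
    simp only [pow_zero, one_mul, sub_self, abs_zero]
    positivity
  | succ t ih =>
    have hmono : Real.sqrt (2 ^ t * ρ) ≤ Real.sqrt (2 ^ (t + 1) * ρ) := by
      refine Real.sqrt_le_sqrt (mul_le_mul_of_nonneg_right ?_ hρ0)
      exact pow_le_pow_right₀ (by norm_num) (Nat.le_succ t)
    have ht' : 23000 * A * Real.sqrt (2 ^ t * ρ) ≤ 1 :=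
      (mul_le_mul_of_nonneg_left hmono (by positivity)).trans ht
    obtain ⟨s, hs, hsT⟩ := ih ht'
    have hsum : ∀ x (c : ℝ), ∑ j : {j // j ∈ s}, c * (ω j * maxSq (b j) x) =
        ∑ j ∈ s, c * (ω j * maxSq (b j) x) := fun x c =>
      Finset.sum_coe_sort s fun j => c * (ω j * maxSq (b j) x)
    obtain ⟨s', hs', hsT'⟩ := exists_half_sum_maxSq (J := {j // j ∈ s}) hn hm hL
      (d := d) (b := fun j => b j) (fun j p => hb j p) (ω := fun j => 2 ^ t * ω j)
      (fun j => mul_nonneg (by positivity) (hω j)) (ρ := 2 ^ t * ρ)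
      (fun j p => by rw [mul_assoc]; exact mul_le_mul_of_nonneg_left (hρ j p) (by positivity))
      h0 hT (fun x hx => by
        simp only [mul_assoc, hsum]
        have h1 := (abs_le.1 (hsT x hx)).2
        have h2 := hT1 x hx
        linarith)
    refine ⟨s'.map (Function.Embedding.subtype _), ?_, fun x hx => ?_⟩
    · rw [Finset.card_map, pow_succ]
      rw [Fintype.card_coe] at hs'
      calc 2 ^ t * 2 * s'.card = 2 ^ t * (2 * s'.card) := by ring
        _ ≤ 2 ^ t * s.card := Nat.mul_le_mul_left _ hs'
        _ ≤ _ := hs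
    · have h1 := hsT' x hx
      simp only [mul_assoc, hsum] at h1
      have h2 := hsT x hx
      have e : ∑ j ∈ s'.map (Function.Embedding.subtype _), 2 ^ (t + 1) * (ω j * maxSq (b j) x) =
          ∑ j ∈ s', 2 * (2 ^ t * (ω j * maxSq (b j) x)) := by
        rw [Finset.sum_map]
        refine Finset.sum_congr rfl fun j _ => ?_
        rw [pow_succ, Function.Embedding.subtype_apply]; ring
      rw [e]
      have h3 : Real.sqrt (2 ^ (t + 1) * ρ) = Real.sqrt 2 * Real.sqrt (2 ^ t * ρ) := by
        rw [← Real.sqrt_mul (by norm_num), pow_succ]; congr 1; ring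
      have h4 : (1.4 : ℝ) ≤ Real.sqrt 2 := Real.le_sqrt_of_sq_le (by norm_num)
      have h5 : 0 ≤ A * Real.sqrt (2 ^ t * ρ) := by positivity
      rw [h3]
      refine (abs_sub_le _ (∑ j ∈ s, 2 ^ t * (ω j * maxSq (b j) x)) _).trans ?_
      nlinarith [mul_le_mul_of_nonneg_right h4 h5]

open Matrix in
/-- Every vector can be replaced, without changing the values of the forms `b i p`, by one whose
Euclidean norm is controlled by these values. -/
lemma exists_controlled_representative {V κ ι : Type*} [Fintype V] [Fintype κ] [Fintype ι]
    (b : ι → κ → V → ℝ) {w : ι → ℝ} (hw : ∀ i, 0 < w i) :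
    ∃ δ : ℝ, 0 < δ ∧ ∀ x : V → ℝ, ∃ y : V → ℝ, (∀ i p, b i p ⬝ᵥ y = b i p ⬝ᵥ x) ∧
      δ * (y ⬝ᵥ y) ≤ ∑ i, w i * maxSq (b i) x := by
  classical
  let D : (V → ℝ) →ₗ[ℝ] (ι → κ → ℝ) :=
    LinearMap.pi fun i => LinearMap.pi fun p => dotProductBilin ℝ ℝ (b i p)
  obtain ⟨G, hG⟩ := D.rangeRestrict.exists_rightInverse_of_surjective D.range_rangeRestrict
  have hGD : ∀ z, D (G z) = z := fun z => by
    have := congrArg Subtype.val (LinearMap.congr_fun hG z)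
    simpa using this
  set C := ‖LinearMap.toContinuousLinearMap G‖ with hC
  set W := ∑ i, (w i)⁻¹ with hW
  have hW0 : 0 ≤ W := Finset.sum_nonneg fun i _ => inv_nonneg.2 (hw i).le
  set N : ℝ := Fintype.card V * C ^ 2 * W with hN
  have hN0 : 0 ≤ N := by positivity
  refine ⟨(N + 1)⁻¹, by positivity, fun x => ⟨G (D.rangeRestrict x), fun i p => ?_, ?_⟩⟩
  · exact congrFun (congrFun (hGD (D.rangeRestrict x)) i) p
  · set Q := ∑ i, w i * maxSq (b i) x with hQ
    have hQ0 : 0 ≤ Q := Finset.sum_nonneg fun i _ => mul_nonneg (hw i).le (maxSq_nonneg _ _)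
    set y := G (D.rangeRestrict x) with hy
    have h1 : ‖y‖ ≤ C * ‖D x‖ := (LinearMap.toContinuousLinearMap G).le_opNorm _
    have h2 : ‖D x‖ ^ 2 ≤ W * Q := by
      have h3 : ‖D x‖ ≤ Real.sqrt (W * Q) := by
        rw [pi_norm_le_iff_of_nonneg (Real.sqrt_nonneg _)]
        intro i
        refine Real.le_sqrt_of_sq_le ?_
        have h4 : w i * maxSq (b i) x ≤ Q :=
          Finset.single_le_sum (f := fun i => w i * maxSq (b i) x)
            (fun i _ => mul_nonneg (hw i).le (maxSq_nonneg _ _)) (Finset.mem_univ i)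
        have h5 : (w i)⁻¹ ≤ W := Finset.single_le_sum (f := fun i => (w i)⁻¹)
            (fun i _ => inv_nonneg.2 (hw i).le) (Finset.mem_univ i)
        calc ‖D x i‖ ^ 2 = maxSq (b i) x := rfl
          _ = (w i)⁻¹ * (w i * maxSq (b i) x) := by rw [inv_mul_cancel_left₀ (hw i).ne']
          _ ≤ W * Q := mul_le_mul h5 h4 (mul_nonneg (hw i).le (maxSq_nonneg _ _)) hW0
      calc ‖D x‖ ^ 2 ≤ Real.sqrt (W * Q) ^ 2 := pow_le_pow_left₀ (norm_nonneg _) h3 2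
        _ = W * Q := Real.sq_sqrt (mul_nonneg hW0 hQ0)
    have h6 : y ⬝ᵥ y ≤ N * Q := by
      calc y ⬝ᵥ y ≤ ∑ _v : V, ‖y‖ ^ 2 := by
            refine Finset.sum_le_sum fun v _ => ?_
            rw [← sq, ← sq_abs]
            exact pow_le_pow_left₀ (abs_nonneg _) (norm_le_pi_norm y v) 2
        _ = Fintype.card V * ‖y‖ ^ 2 := by simp
        _ ≤ Fintype.card V * (C * ‖D x‖) ^ 2 := by gcongr
        _ = Fintype.card V * C ^ 2 * ‖D x‖ ^ 2 := by ring
        _ ≤ Fintype.card V * C ^ 2 * (W * Q) := by gcongr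
        _ = N * Q := by rw [hN]; ring
    rw [inv_mul_le_iff₀ (by positivity)]
    linarith

lemma maxSq_smul {V κ : Type*} [Fintype V] [Fintype κ] (b : κ → V → ℝ) (c : ℝ) (x : V → ℝ) :
    maxSq b (c • x) = c ^ 2 * maxSq b x := by
  have : (fun p => b p ⬝ᵥ (c • x)) = c • fun p => b p ⬝ᵥ x := by
    ext p; simp [dotProduct_smul]
  rw [maxSq, this, norm_smul, mul_pow, Real.norm_eq_abs, sq_abs, maxSq]

open Matrix in
/-- Sparsification of `∑ w_i max_p (b_{i,p} ⬝ᵥ x)²`. Each term is split into copies of about equal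
leverage, and the collection of the copies is halved until few of them are left. -/
theorem exists_sparse_sum_maxSq {V κ ι : Type*} [Fintype V] [Fintype κ] [Fintype ι]
    (hn : 2 ≤ Fintype.card V) (hm : 2 ≤ Fintype.card κ) {d : κ → V → ℝ} {b : ι → κ → V → ℝ}
    (hb : ∀ i p, b i p = 0 ∨ b i p = d p) {w : ι → ℝ} (hw : ∀ i, 0 < w i) {ε : ℝ} (hε : 0 < ε)
    (hε1 : ε ≤ 1) :
    ∃ (s : Finset ι) (w' : ι → ℝ), (∀ i, 0 ≤ w' i) ∧
      (s.card : ℝ) ≤ 2 * (23000 ^ 2 * (Real.log (Fintype.card κ) * Real.log (Fintype.card V)) *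
        Fintype.card V / ε ^ 2) ∧
      ∀ x, |∑ i, w i * maxSq (b i) x - ∑ i ∈ s, w' i * maxSq (b i) x| ≤
        ε * ∑ i, w i * maxSq (b i) x := by
  classical
  have : Nonempty κ := Fintype.card_pos_iff.1 (by omega)
  obtain ⟨δ, hδ, hrep⟩ := exists_controlled_representative b hw
  obtain ⟨L, R, hL, hLQ, hR, hR0, hRsum⟩ := exists_posDef_balanced hδ (fun i => (hw i).le) b
  set Q : (V → ℝ) → ℝ := fun x => ∑ i, w i * maxSq (b i) x with hQ
  have hn0 : (0 : ℝ) < Fintype.card V := by exact_mod_cast (by omega : 0 < Fintype.card V)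
  set n : ℝ := ((Fintype.card V : ℕ) : ℝ) with hn_def
  set A := Real.sqrt (Real.log (Fintype.card κ) * Real.log (Fintype.card V)) with hA
  have hA0 : 0 < A := by linarith [one_half_le_sqrt_log_mul_log hm hn]
  have hA2 : A ^ 2 = Real.log (Fintype.card κ) * Real.log (Fintype.card V) :=
    Real.sq_sqrt (Real.sqrt_pos.1 hA0).le
  rw [← hA2]
  set N₀ := 23000 ^ 2 * A ^ 2 * n / ε ^ 2 with hN₀
  have hN₀pos : 0 < N₀ := by positivity
  obtain ⟨t, ht⟩ := pow_unbounded_of_one_lt (Fintype.card ι / N₀) (one_lt_two (α := ℝ))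
  rw [div_lt_iff₀ hN₀pos] at ht
  set N := 2 ^ t * N₀ with hN
  have hNpos : 0 < N := by positivity
  -- the number of copies of the `i`-th term
  let k : ι → ℕ := fun i => ⌊N * (w i * R i) / n⌋₊ + 1
  have hk : ∀ i, N * (w i * R i) / n ≤ k i := fun i => by
    simp only [k]; push_cast; exact (Nat.lt_floor_add_one _).le
  have hk0 : ∀ i, (0 : ℝ) < k i := fun i => by simp only [k]; positivity
  have hwR : ∀ i, 0 ≤ w i * R i := fun i => mul_nonneg (hw i).le (hR0 i)
  have hksum : ∑ i, (k i : ℝ) ≤ 2 * N := by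
    calc ∑ i, (k i : ℝ) ≤ ∑ i, (N * (w i * R i) / n + 1) := by
          refine Finset.sum_le_sum fun i _ => ?_
          simp only [k]; push_cast
          have := Nat.floor_le (show 0 ≤ N * (w i * R i) / n from
            div_nonneg (mul_nonneg hNpos.le (hwR i)) hn0.le)
          linarith
      _ = N * (∑ i, w i * R i) / n + Fintype.card ι := by
          rw [Finset.sum_add_distrib, Finset.mul_sum, Finset.sum_div]; simp
      _ ≤ N * n / n + N := by gcongr
      _ = 2 * N := by rw [mul_div_assoc, div_self hn0.ne']; ring
  let J := Σ i, Fin (k i)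
  let ω : J → ℝ := fun j => w j.1 / k j.1
  have hω : ∀ j, 0 ≤ ω j := fun j => div_nonneg (hw j.1).le (hk0 j.1).le
  have hsumJ : ∀ x, ∑ j : J, ω j * maxSq (b j.1) x = Q x := fun x => by
    rw [Fintype.sum_sigma]
    refine Finset.sum_congr rfl fun i _ => ?_
    simp only [ω, Finset.sum_const, Finset.card_univ, Fintype.card_fin, nsmul_eq_mul]
    rw [← mul_assoc, mul_div_cancel₀ _ (hk0 i).ne']
  have hcardJ : (Fintype.card J : ℝ) ≤ 2 * N := by
    simp only [J, Fintype.card_sigma, Fintype.card_fin]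
    push_cast
    exact hksum
  have herr : 23000 * A * Real.sqrt (2 ^ t * (n / N)) = ε := by
    have e : 2 ^ t * (n / N) = (ε / (23000 * A)) ^ 2 := by
      rw [hN, hN₀]; field_simp
    rw [e, Real.sqrt_sq (by positivity)]
    field_simp
  -- up to the kernel of the energy and scaling, all vectors belong to `T`
  let T : Set (V → ℝ) := {x | x ⬝ᵥ L *ᵥ x ≤ 2 ∧ Q x ≤ 1}
  have hQsmul : ∀ (c : ℝ) x, Q (c • x) = c ^ 2 * Q x := fun c x => by
    simp only [hQ, maxSq_smul, Finset.mul_sum]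
    exact Finset.sum_congr rfl fun i _ => by ring
  have hQ00 : Q 0 = 0 := by simpa using hQsmul 0 0
  obtain ⟨s, hs, hsT⟩ := exists_iterated_half_sum_maxSq (J := J) hn hm hL (d := d)
    (b := fun j => b j.1) (fun j p => hb j.1 p) hω (ρ := n / N) (by positivity)
    (fun j p => by
      refine (mul_le_mul_of_nonneg_left (hR j.1 p) (hω j)).trans ?_
      have := hk j.1
      have hk0' := hk0 j.1
      rw [div_le_iff₀ hn0] at this
      simp only [ω]
      rw [div_mul_eq_mul_div, div_le_div_iff₀ hk0' hNpos]
      linarith)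
    (T := T) ⟨by simp, by rw [hQ00]; norm_num⟩ (fun x hx => hx.1)
    (fun x hx => by rw [hsumJ]; exact hx.2) t (by rw [← hA, herr]; exact hε1)
  rw [← hA, herr] at hsT
  let w' : ι → ℝ := fun i => ∑ j ∈ s with j.1 = i, 2 ^ t * ω j
  have hw' : ∀ x, ∑ i ∈ s.image Sigma.fst, w' i * maxSq (b i) x =
      ∑ j ∈ s, 2 ^ t * (ω j * maxSq (b j.1) x) := fun x => by
    rw [← Finset.sum_fiberwise_of_maps_to (t := s.image Sigma.fst) (g := Sigma.fst)
      fun j hj => Finset.mem_image_of_mem _ hj]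
    refine Finset.sum_congr rfl fun i _ => ?_
    simp only [w', Finset.sum_mul]
    refine Finset.sum_congr rfl fun j hj => ?_
    rw [(Finset.mem_filter.1 hj).2]; ring
  refine ⟨s.image Sigma.fst, w', fun i => Finset.sum_nonneg fun j _ =>
    mul_nonneg (by positivity) (hω j), ?_, fun x => ?_⟩
  · have h1 : (2 : ℝ) ^ t * s.card ≤ 2 ^ t * (2 * N₀) := by
      have : ((2 ^ t * s.card : ℕ) : ℝ) ≤ Fintype.card J := by exact_mod_cast hs
      push_cast at this
      calc _ ≤ _ := this
        _ ≤ 2 * N := hcardJ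
        _ = _ := by rw [hN]; ring
    calc ((s.image Sigma.fst).card : ℝ) ≤ s.card := by exact_mod_cast Finset.card_image_le
      _ ≤ 2 * N₀ := le_of_mul_le_mul_left h1 (by positivity)
  · show |Q x - ∑ i ∈ s.image Sigma.fst, w' i * maxSq (b i) x| ≤ ε * Q x
    obtain ⟨y, hyb, hyδ⟩ := hrep x
    have hmaxy : ∀ i, maxSq (b i) y = maxSq (b i) x := fun i => by simp only [maxSq, hyb]
    have hQy : Q y = Q x := by simp only [hQ, hmaxy]
    simp only [← hmaxy]
    rw [← hQy]
    change δ * (y ⬝ᵥ y) ≤ Q x at hyδ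
    rw [← hQy] at hyδ
    have hQ0 : 0 ≤ Q y := Finset.sum_nonneg fun i _ => mul_nonneg (hw i).le (maxSq_nonneg _ _)
    rcases hQ0.eq_or_lt with h | h
    · -- a representative of zero energy vanishes
      have hy0 : y = 0 := by
        have h1 : 0 ≤ y ⬝ᵥ y := Finset.sum_nonneg fun v _ => mul_self_nonneg _
        have h2 : y ⬝ᵥ y = 0 := by nlinarith
        exact dotProduct_self_eq_zero.1 h2
      have hm0 : ∀ i, maxSq (b i) (0 : V → ℝ) = 0 := fun i => by
        simpa using maxSq_smul (b i) 0 (0 : V → ℝ)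
      simp [hy0, hm0, hQ00]
    · set c := (Real.sqrt (Q y))⁻¹ with hc
      have hc2 : c ^ 2 * Q y = 1 := by
        rw [hc, inv_pow, Real.sq_sqrt hQ0, inv_mul_cancel₀ h.ne']
      have hcpos : 0 < c ^ 2 := by
        have := Real.sqrt_pos.2 h
        positivity
      have hmem : c • y ∈ T := by
        have hQc : Q (c • y) = 1 := by rw [hQsmul, hc2]
        refine ⟨(hLQ (c • y)).trans ?_, hQc.le⟩
        change δ * ((c • y) ⬝ᵥ (c • y)) + Q (c • y) ≤ 2
        rw [hQc, dotProduct_smul, smul_dotProduct, smul_eq_mul, smul_eq_mul]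
        nlinarith [mul_le_mul_of_nonneg_left hyδ hcpos.le]
      have h1 := hsT _ hmem
      rw [hsumJ, hQsmul, ← hw'] at h1
      simp only [maxSq_smul] at h1
      have e : ∑ i ∈ s.image Sigma.fst, w' i * (c ^ 2 * maxSq (b i) y) - c ^ 2 * Q y =
          c ^ 2 * (∑ i ∈ s.image Sigma.fst, w' i * maxSq (b i) y - Q y) := by
        have e' : ∑ i ∈ s.image Sigma.fst, w' i * (c ^ 2 * maxSq (b i) y) =
            c ^ 2 * ∑ i ∈ s.image Sigma.fst, w' i * maxSq (b i) y := by
          rw [Finset.mul_sum]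
          exact Finset.sum_congr rfl fun i _ => by ring
        rw [e', mul_sub]
      rw [e, abs_mul, abs_of_pos hcpos, abs_sub_comm] at h1
      refine le_of_mul_le_mul_left (h1.trans (le_of_eq ?_)) hcpos
      linear_combination -ε * hc2

/-! ### Hypergraphs -/

section Hypergraph

variable {V : Type*}

lemma edgeEnergy_nonneg (e : Finset V) (x : V → ℝ) : 0 ≤ edgeEnergy e x :=
  Real.iSup_nonneg fun _ => sq_nonneg _

lemma WeightedHypergraph.energy_nonneg (H : WeightedHypergraph V) (x : V → ℝ) : 0 ≤ H.energy x :=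
  Finset.sum_nonneg fun e he => mul_nonneg (H.weight_nonneg e he) (edgeEnergy_nonneg e x)

lemma edgeEnergy_of_subsingleton [Subsingleton V] (e : Finset V) (x : V → ℝ) :
    edgeEnergy e x = 0 := by
  have : IsEmpty {p : V × V // p.1 ∈ e ∧ p.2 ∈ e ∧ p.1 ≠ p.2} :=
    ⟨fun p => p.2.2.2 (Subsingleton.elim _ _)⟩
  exact Real.iSup_of_isEmpty _

/-- The form `x ↦ x_u - x_v` of a pair of vertices. -/
def pairForm [DecidableEq V] (p : V × V) : V → ℝ := Pi.single p.1 1 - Pi.single p.2 1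

lemma pairForm_dotProduct [DecidableEq V] [Fintype V] (p : V × V) (x : V → ℝ) :
    pairForm p ⬝ᵥ x = x p.1 - x p.2 := by
  rw [pairForm, sub_dotProduct, single_dotProduct, single_dotProduct, one_mul, one_mul]

/-- The forms of the pairs of vertices of the hyperedge `e`, extended by `0` to all pairs. -/
def edgeForm [DecidableEq V] (e : Finset V) (p : V × V) : V → ℝ :=
  if p.1 ∈ e ∧ p.2 ∈ e then pairForm p else 0

lemma maxSq_edgeForm [DecidableEq V] [Fintype V] (e : Finset V) (x : V → ℝ) :
    maxSq (edgeForm e) x = edgeEnergy e x := by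
  have hbdd : BddAbove (Set.range fun p : {p : V × V // p.1 ∈ e ∧ p.2 ∈ e ∧ p.1 ≠ p.2} =>
      (x p.1.1 - x p.1.2) ^ 2) := (Set.finite_range _).bddAbove
  refine le_antisymm ?_ (Real.iSup_le (fun p => ?_) (maxSq_nonneg _ _))
  · have h : ‖fun p => edgeForm e p ⬝ᵥ x‖ ≤ Real.sqrt (edgeEnergy e x) := by
      rw [pi_norm_le_iff_of_nonneg (Real.sqrt_nonneg _)]
      intro p
      refine Real.le_sqrt_of_sq_le ?_
      rw [Real.norm_eq_abs, sq_abs]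
      by_cases hp : p.1 ∈ e ∧ p.2 ∈ e
      · rw [edgeForm, if_pos hp, pairForm_dotProduct]
        by_cases hne : p.1 = p.2
        · rw [hne, sub_self]; simpa using edgeEnergy_nonneg e x
        · exact le_ciSup hbdd ⟨p, hp.1, hp.2, hne⟩
      · rw [edgeForm, if_neg hp]; simpa using edgeEnergy_nonneg e x
    calc maxSq (edgeForm e) x ≤ Real.sqrt (edgeEnergy e x) ^ 2 :=
          pow_le_pow_left₀ (norm_nonneg _) h 2
      _ = edgeEnergy e x := Real.sq_sqrt (edgeEnergy_nonneg e x)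
  · have h := sq_dotProduct_le_maxSq (edgeForm e) x p.1
    rwa [edgeForm, if_pos ⟨p.2.1, p.2.2.1⟩, pairForm_dotProduct] at h

/-- The hypergraph without hyperedges is a sparsifier when the energy vanishes or `1 ≤ ε`. -/
lemma exists_empty_sparsifier (H : WeightedHypergraph V) {ε : ℝ}
    (h : ∀ x, H.energy x ≤ ε * H.energy x) :
    ∃ H' : WeightedHypergraph V, H'.IsSpectralSparsifier ε H ∧ H'.edges.card = 0 := by
  refine ⟨⟨∅, fun _ => 0, fun _ _ => le_rfl⟩, ⟨Finset.empty_subset _, fun x => ?_⟩, rfl⟩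
  have h0 : WeightedHypergraph.energy ⟨∅, fun _ => 0, fun _ _ => le_rfl⟩ x = 0 := Finset.sum_empty
  rw [h0, sub_zero, abs_of_nonneg (H.energy_nonneg x)]
  exact h x

theorem WeightedHypergraph.exists_sparsifier [Fintype V] (H : WeightedHypergraph V) {ε : ℝ}
    (hε : 0 < ε) : ∃ H' : WeightedHypergraph V, H'.IsSpectralSparsifier ε H ∧
      (H'.edges.card : ℝ) ≤ 4 * 23000 ^ 2 * (Fintype.card V * Real.log (Fintype.card V) ^ 2) /
        ε ^ 2 := by
  classical
  rcases le_total 1 ε with hε1 | hε1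
  · obtain ⟨H', h1, h2⟩ := exists_empty_sparsifier H (ε := ε) fun x =>
      le_mul_of_one_le_left (H.energy_nonneg x) hε1
    exact ⟨H', h1, by rw [h2, Nat.cast_zero]; positivity⟩
  rcases le_or_gt (Fintype.card V) 1 with hV | hV
  · have : Subsingleton V := Fintype.card_le_one_iff_subsingleton.1 hV
    obtain ⟨H', h1, h2⟩ := exists_empty_sparsifier H (ε := ε) fun x => by
      simp [WeightedHypergraph.energy, edgeEnergy_of_subsingleton]
    exact ⟨H', h1, by rw [h2, Nat.cast_zero]; positivity⟩
  let E := {e // e ∈ H.edges.filter fun e => 0 < H.weight e}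
  have hE : ∀ e : E, e.1 ∈ H.edges ∧ 0 < H.weight e.1 := fun e => Finset.mem_filter.1 e.2
  obtain ⟨s, w', hw'0, hcard, happ⟩ := exists_sparse_sum_maxSq (V := V) (κ := V × V) (ι := E) hV
    (by rw [Fintype.card_prod]; nlinarith) (d := pairForm) (b := fun e => edgeForm e.1)
    (fun e p => by unfold edgeForm; split_ifs <;> simp) (w := fun e => H.weight e.1)
    (fun e => (hE e).2) hε hε1
  have hH : ∀ x, ∑ e : E, H.weight e.1 * maxSq (edgeForm e.1) x = H.energy x := fun x => by
    simp only [maxSq_edgeForm]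
    rw [Finset.sum_coe_sort (H.edges.filter fun e => 0 < H.weight e)
      fun e => H.weight e * edgeEnergy e x, Finset.sum_filter, WeightedHypergraph.energy]
    refine Finset.sum_congr rfl fun e he => ?_
    split_ifs with h
    · rfl
    · rw [le_antisymm (not_lt.1 h) (H.weight_nonneg e he), zero_mul]
  let wt : Finset V → ℝ := fun e => if h : e ∈ H.edges.filter (fun e => 0 < H.weight e)
    then w' ⟨e, h⟩ else 0
  have hwt : ∀ e : E, wt e.1 = w' e := fun e => dif_pos e.2
  let H' : WeightedHypergraph V := ⟨s.map (Function.Embedding.subtype _), wt, fun e _ => by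
    simp only [wt]; split_ifs
    · exact hw'0 _
    · exact le_rfl⟩
  have hH' : ∀ x, H'.energy x = ∑ e ∈ s, w' e * maxSq (edgeForm e.1) x := fun x => by
    simp only [maxSq_edgeForm]
    rw [WeightedHypergraph.energy, Finset.sum_map]
    refine Finset.sum_congr rfl fun e _ => ?_
    exact congrArg (· * edgeEnergy e.1 x) (hwt e)
  refine ⟨H', ⟨fun e he => ?_, fun x => ?_⟩, ?_⟩
  · obtain ⟨e', _, rfl⟩ := Finset.mem_map.1 he
    exact (hE e').1
  · have := happ x
    rwa [hH, ← hH'] at this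
  · have hc : H'.edges.card = s.card := Finset.card_map _
    rw [hc]
    refine hcard.trans (le_of_eq ?_)
    have hV0 : (Fintype.card V : ℝ) ≠ 0 := by
      exact_mod_cast (by omega : Fintype.card V ≠ 0)
    rw [Fintype.card_prod, Nat.cast_mul, Real.log_mul hV0 hV0]
    ring

end Hypergraph

theorem mainTheorem5 :
    (∃ C : ℝ, 0 < C ∧
      ∀ (n m M : ℕ), 2 ≤ n → 2 ≤ m →
      ∀ (A : EuclideanSpace ℝ (Fin n) →ₗ[ℝ] (Fin m → ℝ)) (f : Fin M → (Fin m → ℝ) → ℝ),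
      (∀ j, ∃ K : NNReal, LipschitzWith K (f j)) →
      ∀ T : Set (EuclideanSpace ℝ (Fin n)), T ⊆ Metric.closedBall 0 1 →
      ∀ (Ω : Type*) [MeasurableSpace Ω] (P : Measure Ω) [IsProbabilityMeasure P]
        (ε : Fin M → Ω → ℝ), (∀ j, HasLaw (ε j) signLaw P) → iIndepFun ε P →
      BddAbove (Set.range fun x : T => ∑ j, f j (A x) ^ 2) ∧
      Integrable (fun ω => ⨆ x : T, ∑ j, ε j ω * f j (A x) ^ 2) P ∧
      ∫ ω, (⨆ x : T, ∑ j, ε j ω * f j (A x) ^ 2) ∂P ≤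
        C * Real.sqrt (Real.log m * Real.log n) * twoToInftyNorm A * maxLipConst f *
          ⨆ x : T, Real.sqrt (∑ j, f j (A x) ^ 2)) ∧
    (∃ C : ℝ, 0 < C ∧
      ∀ (V : Type*) [Fintype V] (H : WeightedHypergraph V) (ε : ℝ), 0 < ε →
      ∃ H' : WeightedHypergraph V, H'.IsSpectralSparsifier ε H ∧
        (H'.edges.card : ℝ) ≤
          C * (Fintype.card V * Real.log (Fintype.card V) ^ 2) / ε ^ 2) :=
  ⟨⟨2300, by norm_num, fun _ _ _ hn hm A _ hf _ hT _ _ _ _ _ hε hi =>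
    rademacher_lipschitz_sq_bound hn hm A hf hT hε hi⟩,
  ⟨4 * 23000 ^ 2, by norm_num, fun _ _ H _ hε => H.exists_sparsifier hε⟩⟩
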